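/- Let $N\ge 3$, $\Omega\in\mathbb R$, $\gamma\in\mathbb R\setminus\{0\}$, $a\in\mathbb C\setminus\{0\}$. Consider $N$ identical point vortices of strength $\gamma$ at pairwise distinct positions $z_1,\dots,z_N\in\mathbb C$ on a plane rotating about the origin with constant angular velocity $\Omega$, with equations of motion $$\dot z_j=i\Omega z_j+\overline{\frac{1}{2\pi i}\sum_{k\ne j}\frac{\gamma}{z_j-z_k}},\qquad j=1,\dots,N,$$ that is, the Hamiltonian system $\gamma\dot x_j=-\partial H/\partial y_j$, $\gamma\dot y_j=\partial H/\partial x_j$ ($z_j=x_j+iy_j$) with $$H=\frac{\Omega}{2}\sum_j\gamma|z_j|^2+\frac1{4\pi}\sum_{j<k}\gamma^2\ln|z_j-z_k|^2 .$$ The group $SO(2)$ acts by rotations about the origin, with momentum map $J=\frac12\sum_j\gamma|z_j|^2$. Let $x_e$ be the regular $N$-gon $z_j=a\,e^{2\pi i j/N}$ centred at the origin. Then $x_e$ is a relative equilibrium, i.e. the motion through $x_e$ is $t\mapsto e^{i\xi t}x_e$ for some angular velocity $\xi\in\mathbb R$, and: (i) if $N\le 7$, then $x_e$ is Lyapunov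 stable modulo $SO(2)$: for every $\varepsilon>0$ there is $\delta>0$ such that every motion starting within distance $\delta$ of the orbit $SO(2)\cdot x_e$ exists for all times and stays within distance $\varepsilon$ of this orbit for all $t\ge 0$; (ii) if $N\ge 8$, then $x_e$ is linearly unstable: let $H_\xi=H-\xi\,(J-J(x_e))$, let $\varpi$ be the symplectic form with $\varpi(X_H,\cdot)=dH$, where $X_H$ is the above vector field, and let the symplectic slice $\mathcal N$ be the Euclidean orthogonal complement of $T_{x_e}(SO(2)\cdot x_e)$ inside $\ker DJ(x_e)$; then the linear map $L:\mathcal N\to\mathcal N$ given by $\varpi(Lv,w)=d^2H_\xi(x_e)(v,w)$ for all $v,w\in\mathcal N$ has a complex eigenvalue with positive real part. -/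

import Mathlib

noncomputable section

namespace PointVortex

/-- The phase space: `N`-tuples of pairwise distinct points of the plane `ℂ`. -/
def phaseSpace (N : ℕ) : Set (Fin N → ℂ) :=
  {z | Function.Injective z}

/-- The equations of motion of `N` point vortices with vorticities `lam j` on a plane that rotates
about the origin with constant angular velocity `Ω`:
`dz_j/dt = i Ω z_j + conj ((1 / (2 π i)) ∑_{k ≠ j} lam_k / (z_j - z_k))`. -/
def vectorField {N : ℕ} (Ω : ℝ) (lam : Fin N → ℝ) (z : Fin N → ℂ) : Fin N → ℂ := fun j =>
  Complex.I * (Ω : ℂ) * z j +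
    (starRingEnd ℂ) ((1 / (2 * (Real.pi : ℂ) * Complex.I)) *
      ∑ k ∈ Finset.univ.erase j, (lam k : ℂ) / (z j - z k))

/-- `c` is a motion of the vortices, defined for all times and free of collisions. -/
def IsMotion {N : ℕ} (Ω : ℝ) (lam : Fin N → ℝ) (c : ℝ → Fin N → ℂ) : Prop :=
  ∀ t : ℝ, c t ∈ phaseSpace N ∧ HasDerivAt c (vectorField Ω lam (c t)) t

/-- `x` is a relative equilibrium with angular velocity `ξ`: the motion through `x` is
the rigid rotation `t ↦ exp (i ξ t) • x`. -/
def IsRelativeEquilibrium {N : ℕ} (Ω : ℝ) (lam : Fin N → ℝ) (x : Fin N → ℂ) (ξ : ℝ) : Prop :=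
  IsMotion Ω lam (fun t => Complex.exp (((ξ * t : ℝ) : ℂ) * Complex.I) • x)

/-- `y` lies within distance less than `ε` of the `SO(2)`-orbit of `x`, where `SO(2)` is the group
of rotations about the origin. -/
def NearOrbit {N : ℕ} (ε : ℝ) (x y : Fin N → ℂ) : Prop :=
  ∃ g : Circle, dist y ((g : ℂ) • x) < ε

/-- Lyapunov stability of `x` modulo `SO(2)`: every motion that starts near enough to the orbit of
`x` exists for all times and stays as near to that orbit as prescribed. -/
def IsLyapunovStableModSO2 {N : ℕ} (Ω : ℝ) (lam : Fin N → ℝ) (x : Fin N → ℂ) : Prop :=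
  ∀ ε > 0, ∃ δ > 0, ∀ y ∈ phaseSpace N, NearOrbit δ x y →
    (∃ c, IsMotion Ω lam c ∧ c 0 = y) ∧
    ∀ c, IsMotion Ω lam c → c 0 = y → ∀ t : ℝ, 0 ≤ t → NearOrbit ε x (c t)

/-- The Hamiltonian of the vortices on the rotating plane. -/
def hamiltonian {N : ℕ} (Ω : ℝ) (lam : Fin N → ℝ) (z : Fin N → ℂ) : ℝ :=
  Ω / 2 * ∑ j, lam j * ‖z j‖ ^ 2 +
    1 / (4 * Real.pi) * ∑ i, ∑ j ∈ Finset.Ioi i, lam i * lam j * Real.log (‖z i - z j‖ ^ 2)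

/-- The momentum map of the action of `SO(2)`. -/
def momentum {N : ℕ} (lam : Fin N → ℝ) (z : Fin N → ℂ) : ℝ :=
  (∑ j, lam j * ‖z j‖ ^ 2) / 2

/-- The symplectic form `∑ lam_j dy_j ∧ dx_j`, for which Hamilton's equation
`symplecticForm X_H w = dH w` reads `lam_j dx_j/dt = - ∂H/∂y_j`, `lam_j dy_j/dt = ∂H/∂x_j`. -/
def symplecticForm {N : ℕ} (lam : Fin N → ℝ) (v w : Fin N → ℂ) : ℝ :=
  ∑ j, lam j * ((v j).im * (w j).re - (v j).re * (w j).im)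

/-- The augmented Hamiltonian `H_ξ = H - (J - J(x)) ξ` at the configuration `x`. -/
def augmentedHamiltonian {N : ℕ} (Ω : ℝ) (lam : Fin N → ℝ) (x : Fin N → ℂ) (ξ : ℝ)
    (z : Fin N → ℂ) : ℝ :=
  hamiltonian Ω lam z - (momentum lam z - momentum lam x) * ξ

/-- The orthogonal complement, for the Euclidean inner product of `ℂ^N = ℝ^(2N)`, of the tangent
line at `x` to the `SO(2)`-orbit of `x`; this line is spanned by `i x`. -/
def orbitNormal {N : ℕ} (x : Fin N → ℂ) : Submodule ℝ (Fin N → ℂ) where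
  carrier := {v | ∑ j, ((v j).re * (Complex.I * x j).re + (v j).im * (Complex.I * x j).im) = 0}
  zero_mem' := by simp
  add_mem' := by
    intro v w hv hw
    simp only [Set.mem_ofPred_eq] at hv hw ⊢
    rw [← add_zero (0 : ℝ)]
    nth_rewrite 1 [← hv]
    rw [← hw, ← Finset.sum_add_distrib]
    refine Finset.sum_congr rfl fun j _ => ?_
    simp only [Pi.add_apply, Complex.add_re, Complex.add_im]
    ring
  smul_mem' := by
    intro r v hv
    simp only [Set.mem_ofPred_eq] at hv ⊢
    rw [← mul_zero r, ← hv, Finset.mul_sum]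
    refine Finset.sum_congr rfl fun j _ => ?_
    simp only [Pi.smul_apply, Complex.smul_re, Complex.smul_im, smul_eq_mul]
    ring

/-- The symplectic slice at `x`: the orthogonal complement of the tangent space to the group orbit,
inside the kernel of the derivative of the momentum map. -/
def symplecticSlice {N : ℕ} (lam : Fin N → ℝ) (x : Fin N → ℂ) : Submodule ℝ (Fin N → ℂ) :=
  orbitNormal x ⊓ LinearMap.ker (fderiv ℝ (momentum lam) x : (Fin N → ℂ) →ₗ[ℝ] ℝ)

/-- `L` is the linearization at `x` in the symplectic slice, that is, the endomorphism which the
symplectic form associates with the Hessian of `H_ξ` at `x` restricted to the slice. -/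
def IsSliceLinearization {N : ℕ} (Ω : ℝ) (lam : Fin N → ℝ) (x : Fin N → ℂ) (ξ : ℝ)
    (L : symplecticSlice lam x →ₗ[ℝ] symplecticSlice lam x) : Prop :=
  ∀ v w : symplecticSlice lam x,
    symplecticForm lam (L v : Fin N → ℂ) (w : Fin N → ℂ) =
      fderiv ℝ (fderiv ℝ (augmentedHamiltonian Ω lam x ξ)) x (v : Fin N → ℂ) (w : Fin N → ℂ)

/-- Linear instability of a relative equilibrium `x` of angular velocity `ξ`: the linearization in
the symplectic slice has a complex eigenvalue with positive real part. -/
def IsLinearlyUnstable {N : ℕ} (Ω : ℝ) (lam : Fin N → ℝ) (x : Fin N → ℂ) (ξ : ℝ) : Prop :=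
  ∃ L : symplecticSlice lam x →ₗ[ℝ] symplecticSlice lam x,
    IsSliceLinearization Ω lam x ξ L ∧
      ∃ μ : ℂ, 0 < μ.re ∧ Module.End.HasEigenvalue (L.baseChange ℂ) μ

/-- The vertices of the regular `N`-gon centred at the origin with one vertex at `a`. -/
def regularPolygon (N : ℕ) (a : ℂ) : Fin N → ℂ := fun j =>
  a * Complex.exp (2 * (Real.pi : ℂ) * Complex.I * ((j : ℕ) : ℂ) / (N : ℂ))

end PointVortex

end

/-!
Write `x_j = a e_j` for the vertices of the regular polygon, where `e_j = unityRoot j`.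

*Energy.* A configuration of nonzero amplitude is `z_j = x_j A (1 + u_j)` with `∑ u_j = 0`. Then
`z_j - z_k = (x_j - x_k) A (1 + pairRatio u j k)`, and `∑ |z_j|² = N |a|² |A|² (1 + ∑ |u_j|² / N)`.
Hence the conserved quantity `∑ log |z_j - z_k|² - N (N - 1) log (∑ |z_j|²)`, which is invariant
under rotations and dilations, is up to a constant the function `relativeEnergy` of `u` alone
(`logEnergy_sub_eq`). Its second order part is `-Re ∑ (pairRatio u j k)² - (N - 1) ∑ |u_j|²`. The
Fourier modes diagonalise the first term (`pairOperator_mode`), with the eigenvalues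
`λ_m = (N - 1 - m (N - m)) / 2`, so that this part is negative definite when `2 |λ_m| < N - 1`, that
is, `m (N - m) < 2 (N - 1)`, for all `m ≠ 0`.

*At most seven vertices.* The condition holds for `N ≤ 6`. For `N = 7` there is equality at the
modes `3` and `4`, and the second order part has a two-dimensional kernel, parametrised by `c ∈ ℂ`.
There the third order part vanishes, but it couples the kernel with the mode `1`. The fourth order
part remains negative definite after the displacement in the mode `1` that makes the most of this
coupling (`exists_kernelMode_decomposition`, `sum_log_le_seven`). So
`relativeEnergy u ≤ -κ (∑ |u_j|²)²` near `0` in all cases (`relativeEnergy_le`): the polygon is a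
strict maximum of a conserved quantity, modulo rotations and dilations, and the size is controlled
because `∑ |z_j|²` is conserved. This gives Lyapunov stability (`isLyapunovStable_regularPolygon`).

*Motions exist for all times.* Vortices of equal strength do not collide: `∑ |z_j|²` bounds the
distances from above, and then the energy bounds them from below. The same bound for an interaction
that is cut off at short distances, for which the equations have global solutions, shows that the
cut off is never felt (`exists_motion`).

*At least eight vertices.* The Hessian of the augmented Hamiltonian has the linearised equations
`u ↦ -i κ ((N - 1) u + 2 conj (pairOperator u))` as its Hamiltonian field
(`symplecticForm_polygonLinearization`), and the slice is `∑ u_j = 0`. The complex multiples of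
`Re e_j³` form an invariant real plane, on which the determinant is `-3 κ² (N - 3) (N - 7) < 0`.
So there is a positive real eigenvalue (`exists_eigenvector_linearizedField`).
-/

namespace PointVortex

/-! ### Roots of unity -/

/-- The `N`-th root of unity `exp (2 π i j / N)`, indexed by the residue `j`. -/
noncomputable def unityRoot {N : ℕ} (j : Fin N) : ℂ :=
  Complex.exp (2 * (Real.pi : ℂ) * Complex.I * ((j : ℕ) : ℂ) / (N : ℂ))

section Roots

variable {N : ℕ}

theorem unityRoot_eq_pow (j : Fin N) :
    unityRoot j = Complex.exp (2 * (Real.pi : ℂ) * Complex.I / (N : ℂ)) ^ (j : ℕ) := by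
  rw [unityRoot, ← Complex.exp_nat_mul]
  congr 1
  ring

@[simp] theorem unityRoot_ne_zero (j : Fin N) : unityRoot j ≠ 0 := Complex.exp_ne_zero _

theorem unityRoot_pow_comm (j m : Fin N) :
    unityRoot j ^ (m : ℕ) = unityRoot m ^ (j : ℕ) := by
  rw [unityRoot_eq_pow, unityRoot_eq_pow, pow_right_comm]

variable [NeZero N]

theorem isPrimitiveRoot_base :
    IsPrimitiveRoot (Complex.exp (2 * (Real.pi : ℂ) * Complex.I / (N : ℂ))) N :=
  Complex.isPrimitiveRoot_exp N (NeZero.ne N)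

@[simp] theorem unityRoot_zero : unityRoot (0 : Fin N) = 1 := by
  simp [unityRoot]

theorem unityRoot_add (i j : Fin N) : unityRoot (i + j) = unityRoot i * unityRoot j := by
  simp only [unityRoot_eq_pow, Fin.val_add, ← pow_add]
  exact (pow_eq_pow_mod _ isPrimitiveRoot_base.pow_eq_one).symm

@[simp] theorem unityRoot_pow_card (j : Fin N) : unityRoot j ^ N = 1 := by
  rw [unityRoot_eq_pow, pow_right_comm, isPrimitiveRoot_base.pow_eq_one, one_pow]

@[simp] theorem norm_unityRoot (j : Fin N) : ‖unityRoot j‖ = 1 :=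
  Complex.norm_eq_one_of_pow_eq_one (unityRoot_pow_card j) (NeZero.ne N)

theorem conj_unityRoot (j : Fin N) : (starRingEnd ℂ) (unityRoot j) = (unityRoot j)⁻¹ :=
  (Complex.inv_eq_conj (norm_unityRoot j)).symm

theorem unityRoot_injective : Function.Injective (unityRoot : Fin N → ℂ) := by
  intro i j h
  rw [unityRoot_eq_pow, unityRoot_eq_pow] at h
  exact Fin.ext (isPrimitiveRoot_base.pow_inj i.2 j.2 h)

theorem unityRoot_ne_one {r : Fin N} (hr : r ≠ 0) : unityRoot r ≠ 1 := by
  rw [← unityRoot_zero (N := N)]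
  exact fun h => hr (unityRoot_injective h)

theorem unityRoot_neg (j : Fin N) : unityRoot (-j) = (unityRoot j)⁻¹ := by
  refine eq_inv_of_mul_eq_one_left ?_
  rw [← unityRoot_add, neg_add_cancel, unityRoot_zero]

theorem sum_unityRoot_pow (l : ℕ) :
    ∑ j : Fin N, unityRoot j ^ l = if N ∣ l then (N : ℂ) else 0 := by
  set ζ := Complex.exp (2 * (Real.pi : ℂ) * Complex.I / (N : ℂ)) with hζ
  have h1 : ∀ j : Fin N, unityRoot j ^ l = (ζ ^ l) ^ (j : ℕ) := by
    intro j
    rw [unityRoot_eq_pow, pow_right_comm]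
  simp only [h1]
  rw [Fin.sum_univ_eq_sum_range (fun j => (ζ ^ l) ^ j) N]
  have hprim : IsPrimitiveRoot ζ N := isPrimitiveRoot_base
  split_ifs with h
  · rw [(hprim.pow_eq_one_iff_dvd l).2 h]
    simp
  · have hne : ζ ^ l ≠ 1 := fun h' => h ((hprim.pow_eq_one_iff_dvd l).1 h')
    rw [geom_sum_eq hne, ← pow_mul, mul_comm, pow_mul, hprim.pow_eq_one]
    simp

/-- Sums over `k` of functions of `k` may be recentred at any `j`. -/
theorem sum_shift {M : Type*} [AddCommMonoid M] (j : Fin N) (f : Fin N → M) :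
    ∑ k, f k = ∑ r, f (j + r) :=
  (Equiv.sum_comp (Equiv.addLeft j) f).symm

/-- The summand at `r = 0` is `0`, because of the division by `0`; the same holds for the sums of
`sum_pow_div_one_sub` and `sum_modeEigenvalue`. The summands at `r` and `-r` add up to `1`. -/
theorem sum_inv_one_sub : ∑ r : Fin N, 1 / (1 - unityRoot r) = ((N : ℂ) - 1) / 2 := by
  have h1 : ∑ r : Fin N, 1 / (1 - unityRoot r) = ∑ r : Fin N, 1 / (1 - unityRoot (-r)) :=
    (Equiv.sum_comp (Equiv.neg (Fin N)) (fun r => 1 / (1 - unityRoot r))).symm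
  have h2 : ∀ r : Fin N, 1 / (1 - unityRoot r) + 1 / (1 - unityRoot (-r)) =
      1 - if r = 0 then 1 else 0 := by
    intro r
    split_ifs with h
    · simp [h]
    · have h3 := unityRoot_ne_one h
      have h4 := unityRoot_ne_zero r
      have h5 : 1 - unityRoot r ≠ 0 := sub_ne_zero.2 h3.symm
      have h6 : unityRoot r - 1 ≠ 0 := sub_ne_zero.2 h3
      rw [unityRoot_neg]
      have h7 : 1 - (unityRoot r)⁻¹ = (unityRoot r - 1) / unityRoot r := by field_simp
      rw [h7, one_div_div, sub_zero, ← neg_sub (unityRoot r) 1]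
      field_simp
      ring
  have h3 : ∑ r : Fin N, (1 / (1 - unityRoot r) + 1 / (1 - unityRoot (-r))) = (N : ℂ) - 1 := by
    simp only [h2, Finset.sum_sub_distrib]
    simp
  rw [Finset.sum_add_distrib, ← h1] at h3
  linear_combination h3 / 2

theorem sum_pow_div_one_sub (m : ℕ) (hm : m < N) :
    ∑ r : Fin N, unityRoot r ^ (m + 1) / (1 - unityRoot r) = (m : ℂ) - ((N : ℂ) - 1) / 2 := by
  have step : ∀ m : ℕ, ∑ r : Fin N, unityRoot r ^ (m + 1) / (1 - unityRoot r) =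
      ∑ r : Fin N, unityRoot r ^ m / (1 - unityRoot r) -
        ∑ r : Fin N, unityRoot r ^ m + 1 := by
    intro m
    have h : ∀ r : Fin N, unityRoot r ^ (m + 1) / (1 - unityRoot r) =
        unityRoot r ^ m / (1 - unityRoot r) - unityRoot r ^ m + if r = 0 then 1 else 0 := by
      intro r
      split_ifs with h
      · simp [h]
      · have h5 : 1 - unityRoot r ≠ 0 := sub_ne_zero.2 (unityRoot_ne_one h).symm
        field_simp
        ring
    simp only [h, Finset.sum_add_distrib, Finset.sum_sub_distrib]
    simp
  induction m with
  | zero =>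
    rw [step, sum_unityRoot_pow]
    have := sum_inv_one_sub (N := N)
    simp only [pow_zero, this, dvd_zero, if_true]
    push_cast
    ring
  | succ m ih =>
    rw [step, ih (by omega), sum_unityRoot_pow, if_neg (Nat.not_dvd_of_pos_of_lt (by omega) hm)]
    push_cast
    ring

/-- The value of `∑_{r ≠ 0} (1 - ω_r^(m+1)) / (1 - ω_r)^2`, where `ω_r` are the `N`-th roots of
unity: the eigenvalue, at the mode `m`, of the operator `pairOperator` below. -/
noncomputable def modeEigenvalue (N m : ℕ) : ℝ := ((N : ℝ) - 1 - m * ((N : ℝ) - m)) / 2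

theorem sum_modeEigenvalue (m : ℕ) (hm : m < N) :
    ∑ r : Fin N, (1 - unityRoot r ^ (m + 1)) / (1 - unityRoot r) / (1 - unityRoot r) =
      (modeEigenvalue N m : ℂ) := by
  induction m with
  | zero =>
    have h : ∀ r : Fin N, (1 - unityRoot r ^ (0 + 1)) / (1 - unityRoot r) / (1 - unityRoot r) =
        1 / (1 - unityRoot r) := by
      intro r
      by_cases h : r = 0
      · simp [h]
      · have h5 : 1 - unityRoot r ≠ 0 := sub_ne_zero.2 (unityRoot_ne_one h).symm
        field_simp
        ring
    simp only [h, sum_inv_one_sub, modeEigenvalue]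
    push_cast
    ring
  | succ m ih =>
    have h : ∀ r : Fin N,
        (1 - unityRoot r ^ (m + 1 + 1)) / (1 - unityRoot r) / (1 - unityRoot r) =
        (1 - unityRoot r ^ (m + 1)) / (1 - unityRoot r) / (1 - unityRoot r) +
          unityRoot r ^ (m + 1) / (1 - unityRoot r) := by
      intro r
      by_cases h : r = 0
      · simp [h]
      · have h5 : 1 - unityRoot r ≠ 0 := sub_ne_zero.2 (unityRoot_ne_one h).symm
        field_simp
        ring
    simp only [h, Finset.sum_add_distrib]
    rw [ih (by omega), sum_pow_div_one_sub m (by omega), modeEigenvalue, modeEigenvalue]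
    push_cast
    ring

end Roots

/-! ### The discrete Fourier transform -/

section Fourier

variable {N : ℕ} [NeZero N]

theorem conj_pow_mul_pow (j m m' : Fin N) :
    (starRingEnd ℂ) (unityRoot j ^ (m : ℕ)) * unityRoot j ^ (m' : ℕ) =
      unityRoot j ^ (N - (m : ℕ) + (m' : ℕ)) := by
  rw [pow_add, map_pow, conj_unityRoot, pow_sub₀ _ (unityRoot_ne_zero j) m.2.le,
    unityRoot_pow_card, one_mul, inv_pow]

theorem sum_conj_pow_mul_pow (m m' : Fin N) :
    ∑ j : Fin N, (starRingEnd ℂ) (unityRoot j ^ (m : ℕ)) * unityRoot j ^ (m' : ℕ) =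
      if m = m' then (N : ℂ) else 0 := by
  simp only [conj_pow_mul_pow, sum_unityRoot_pow]
  refine if_congr ?_ rfl rfl
  have h1 := m.2
  have h2 := m'.2
  constructor
  · rintro ⟨k, hk⟩
    have hk1 : k = 1 := by
      rcases Nat.lt_trichotomy k 1 with h | h | h
      · have : k = 0 := by omega
        subst this
        omega
      · exact h
      · have : N * 2 ≤ N * k := Nat.mul_le_mul_left N h
        omega
    subst hk1
    exact Fin.ext (by omega)
  · rintro rfl
    exact ⟨1, by omega⟩

theorem unityRoot_pow_neg_val (j m : Fin N) :
    unityRoot j ^ ((-m : Fin N) : ℕ) = (starRingEnd ℂ) (unityRoot j ^ (m : ℕ)) := by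
  rw [unityRoot_pow_comm, unityRoot_neg, inv_pow, ← unityRoot_pow_comm, map_pow, conj_unityRoot,
    inv_pow]

/-- The discrete Fourier coefficients of `u`. -/
noncomputable def fourierCoeff (u : Fin N → ℂ) (m : Fin N) : ℂ :=
  (∑ j, u j * (starRingEnd ℂ) (unityRoot j ^ (m : ℕ))) / N

theorem natCast_ne_zero_of_neZero : (N : ℂ) ≠ 0 := Nat.cast_ne_zero.2 (NeZero.ne N)

theorem sum_fourierCoeff_mul (u : Fin N → ℂ) (j : Fin N) :
    ∑ m, fourierCoeff u m * unityRoot j ^ (m : ℕ) = u j := by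
  have hN := natCast_ne_zero_of_neZero (N := N)
  simp only [fourierCoeff, Finset.sum_div, Finset.sum_mul]
  rw [Finset.sum_comm]
  have h : ∀ k : Fin N, ∑ m : Fin N, u k * (starRingEnd ℂ) (unityRoot k ^ (m : ℕ)) / N *
      unityRoot j ^ (m : ℕ) = if k = j then u k else 0 := by
    intro k
    have h1 : ∀ m : Fin N, u k * (starRingEnd ℂ) (unityRoot k ^ (m : ℕ)) / N *
        unityRoot j ^ (m : ℕ) = u k / N * ((starRingEnd ℂ) (unityRoot m ^ (k : ℕ)) *
          unityRoot m ^ (j : ℕ)) := by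
      intro m
      rw [unityRoot_pow_comm k m, unityRoot_pow_comm j m]
      ring
    simp only [h1, ← Finset.mul_sum, sum_conj_pow_mul_pow]
    split_ifs <;> field_simp
    simp
  simp only [h]
  simp

theorem sum_normSq_eq_fourierCoeff (u : Fin N → ℂ) :
    ∑ j, ‖u j‖ ^ 2 = N * ∑ m, ‖fourierCoeff u m‖ ^ 2 := by
  have hN := natCast_ne_zero_of_neZero (N := N)
  have key : ∑ j, (starRingEnd ℂ) (u j) * u j =
      N * ∑ m, (starRingEnd ℂ) (fourierCoeff u m) * fourierCoeff u m := by
    calc ∑ j, (starRingEnd ℂ) (u j) * u j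
        = ∑ j, (∑ m, (starRingEnd ℂ) (fourierCoeff u m * unityRoot j ^ (m : ℕ))) * u j := by
          refine Finset.sum_congr rfl fun j _ => ?_
          rw [← map_sum, sum_fourierCoeff_mul]
      _ = ∑ m, (starRingEnd ℂ) (fourierCoeff u m) *
            ∑ j, u j * (starRingEnd ℂ) (unityRoot j ^ (m : ℕ)) := by
          simp only [Finset.sum_mul, Finset.mul_sum]
          rw [Finset.sum_comm]
          refine Finset.sum_congr rfl fun m _ => Finset.sum_congr rfl fun j _ => ?_
          rw [map_mul]
          ring
      _ = _ := by
          rw [Finset.mul_sum]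
          refine Finset.sum_congr rfl fun m _ => ?_
          rw [fourierCoeff]
          field_simp
  simp only [Complex.conj_mul'] at key
  exact_mod_cast key

theorem fourierCoeff_zero (u : Fin N → ℂ) (hu : ∑ j, u j = 0) : fourierCoeff u 0 = 0 := by
  simp [fourierCoeff, hu]

end Fourier

/-! ### Global integral curves -/

section GlobalSolutions

open Set in
/-- A bounded and globally Lipschitz vector field has integral curves defined for all times. -/
theorem exists_global_integralCurve {E : Type*} [NormedAddCommGroup E] [NormedSpace ℝ E]
    [CompleteSpace E] (Y : E → E) {K L : NNReal} (hK : LipschitzWith K Y) (hL : ∀ x, ‖Y x‖ ≤ L)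
    (y : E) : ∃ c : ℝ → E, c 0 = y ∧ ∀ t, HasDerivAt c (Y (c t)) t := by
  have hloc : ∀ n : ℕ, ∃ c : ℝ → E, c 0 = y ∧
      ∀ t ∈ Ioo (-((n : ℝ) + 1)) ((n : ℝ) + 1), HasDerivAt c (Y (c t)) t := by
    intro n
    have h0 : (0 : ℝ) ∈ Icc (-((n : ℝ) + 1)) ((n : ℝ) + 1) := by
      constructor <;> linarith [n.cast_nonneg (α := ℝ)]
    have hP : IsPicardLindelof (fun _ => Y) (⟨0, h0⟩ : Icc (-((n : ℝ) + 1)) ((n : ℝ) + 1)) y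
        (L * ((n : NNReal) + 1)) 0 L K := by
      refine IsPicardLindelof.of_time_independent (fun x _ => hL x) hK.lipschitzOnWith ?_
      push_cast
      simp
    obtain ⟨c, hc0, hc⟩ := hP.exists_eq_forall_mem_Icc_hasDerivWithinAt₀
    exact ⟨c, hc0, fun t ht => (hc t (Ioo_subset_Icc_self ht)).hasDerivAt
      (Icc_mem_nhds ht.1 ht.2)⟩
  choose α hα0 hα using hloc
  have huniq : ∀ n m : ℕ, n ≤ m → EqOn (α n) (α m) (Ioo (-((n : ℝ) + 1)) ((n : ℝ) + 1)) := by
    intro n m hnm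
    have hnm' : (n : ℝ) ≤ m := Nat.cast_le.2 hnm
    refine ODE_solution_unique_of_mem_Ioo (v := fun _ => Y) (s := fun _ => univ) (K := K)
      (t₀ := 0) (fun t _ => hK.lipschitzOnWith) ?_ (fun t ht => ⟨hα n t ht, mem_univ _⟩)
      (fun t ht => ⟨hα m t ⟨by linarith [ht.1], by linarith [ht.2]⟩, mem_univ _⟩) ?_
    · constructor <;> linarith [n.cast_nonneg (α := ℝ)]
    · rw [hα0, hα0]
  -- The solutions on the intervals `(-(n + 1), n + 1)` agree where they overlap, and are glued.
  refine ⟨fun t => α ⌈|t|⌉₊ t, by simp [hα0], fun t => ?_⟩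
  set n := ⌈|t|⌉₊ with hn
  have htn : |t| ≤ n := Nat.le_ceil _
  have hmem : ∀ s : ℝ, s ∈ Ioo (-((⌈|s|⌉₊ : ℝ) + 1)) ((⌈|s|⌉₊ : ℝ) + 1) := fun s =>
    abs_lt.1 (by linarith [Nat.le_ceil |s|])
  have hEq : (fun s => α ⌈|s|⌉₊ s) =ᶠ[nhds t] α (n + 1) := by
    have hnhds : Ioo (-((n : ℝ) + 1)) ((n : ℝ) + 1) ∈ nhds t :=
      Ioo_mem_nhds (hmem t).1 (hmem t).2
    filter_upwards [hnhds] with s hs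
    refine huniq _ _ ?_ (hmem s)
    refine Nat.ceil_le.2 ?_
    push_cast
    exact (abs_lt.2 hs).le
  have hEqt : α n t = α (n + 1) t := huniq n (n + 1) (Nat.le_succ n) (hmem t)
  have h1 : HasDerivAt (α (n + 1)) (Y (α (n + 1) t)) t := by
    refine hα (n + 1) t ?_
    have := hmem t
    push_cast
    exact ⟨by linarith [this.1], by linarith [this.2]⟩
  have h2 : Y (α ⌈|t|⌉₊ t) = Y (α (n + 1) t) := by rw [← hn, hEqt]
  beta_reduce
  rw [h2]
  exact h1.congr_of_eventuallyEq hEq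

end GlobalSolutions

/-! ### Conservation laws -/

section Conservation

variable {N : ℕ}

/-- The sum of the central forces `ψ (|z_j - z_k|²) (z_j - z_k)` of the other points on `z_j`. -/
noncomputable def interaction (ψ : ℝ → ℝ) (z : Fin N → ℂ) (j : Fin N) : ℂ :=
  ∑ k, (ψ (‖z j - z k‖ ^ 2) : ℂ) * (z j - z k)

/-- The vortex equations of motion with a general profile `ψ` of the interaction; the point
vortices have `ψ s = 1 / s`. -/
noncomputable def profileField (Ω κ : ℝ) (ψ : ℝ → ℝ) (z : Fin N → ℂ) (j : Fin N) : ℂ :=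
  Complex.I * Ω * z j + Complex.I * κ * interaction ψ z j

/-- The central forces have a real virial: symmetrising in `j` and `k` turns `conj z_j (z_j - z_k)`
into `|z_j - z_k|² / 2`. -/
theorem sum_conj_mul_interaction (ψ : ℝ → ℝ) (z : Fin N → ℂ) :
    ∑ j, (starRingEnd ℂ) (z j) * interaction ψ z j =
      (((∑ j, ∑ k, ψ (‖z j - z k‖ ^ 2) * ‖z j - z k‖ ^ 2) / 2 : ℝ) : ℂ) := by
  have h1 : ∑ j, (starRingEnd ℂ) (z j) * interaction ψ z j =
      ∑ j, ∑ k, (ψ (‖z j - z k‖ ^ 2) : ℂ) * ((starRingEnd ℂ) (z j) * (z j - z k)) := by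
    simp only [interaction, Finset.mul_sum]
    exact Finset.sum_congr rfl fun j _ => Finset.sum_congr rfl fun k _ => by ring
  have h2 : ∑ j, (starRingEnd ℂ) (z j) * interaction ψ z j =
      ∑ j, ∑ k, (ψ (‖z j - z k‖ ^ 2) : ℂ) * ((starRingEnd ℂ) (z k) * (z k - z j)) := by
    rw [h1, Finset.sum_comm]
    exact Finset.sum_congr rfl fun j _ => Finset.sum_congr rfl fun k _ => by rw [norm_sub_rev]
  have h3 : ((∑ j, ∑ k, ψ (‖z j - z k‖ ^ 2) * ‖z j - z k‖ ^ 2 : ℝ) : ℂ) =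
      ∑ j, ∑ k, (ψ (‖z j - z k‖ ^ 2) : ℂ) * ((starRingEnd ℂ) (z j) * (z j - z k)) +
      ∑ j, ∑ k, (ψ (‖z j - z k‖ ^ 2) : ℂ) * ((starRingEnd ℂ) (z k) * (z k - z j)) := by
    push_cast
    simp only [← Finset.sum_add_distrib]
    refine Finset.sum_congr rfl fun j _ => Finset.sum_congr rfl fun k _ => ?_
    rw [← Complex.conj_mul', map_sub]
    ring
  rw [Complex.ofReal_div, h3, ← h1, ← h2]
  push_cast
  ring

variable {Ω κ : ℝ} {ψ : ℝ → ℝ} {c : ℝ → Fin N → ℂ}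

/-- The sum of the squared moduli is conserved, whatever the profile. -/
theorem sum_normSq_conserved (hc : ∀ t, HasDerivAt c (profileField Ω κ ψ (c t)) t) (t : ℝ) :
    ∑ j, ‖c t j‖ ^ 2 = ∑ j, ‖c 0 j‖ ^ 2 := by
  have hd : ∀ t, HasDerivAt (fun s => ∑ j, ‖c s j‖ ^ 2) 0 t := by
    intro t
    have h1 : HasDerivAt (fun s => ∑ j, ‖c s j‖ ^ 2)
        (∑ j, 2 * inner ℝ (c t j) (profileField Ω κ ψ (c t) j)) t :=
      HasDerivAt.fun_sum fun j _ => (hasDerivAt_pi.1 (hc t) j).norm_sq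
    have h2 : ∑ j, 2 * inner ℝ (c t j) (profileField Ω κ ψ (c t) j) = 0 := by
      have h3 : ∑ j, 2 * inner ℝ (c t j) (profileField Ω κ ψ (c t) j) =
          (2 * (Complex.I * Ω * ∑ j, ((‖c t j‖ ^ 2 : ℝ) : ℂ) + Complex.I * κ *
            ∑ j, (starRingEnd ℂ) (c t j) * interaction ψ (c t) j)).re := by
        simp only [Finset.mul_sum, ← Finset.sum_add_distrib, Complex.re_sum]
        refine Finset.sum_congr rfl fun j _ => ?_
        rw [Complex.inner, ← Complex.re_ofReal_mul, profileField]
        congr 1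
        push_cast
        rw [← Complex.conj_mul']
        ring
      rw [h3, sum_conj_mul_interaction, ← Complex.ofReal_sum]
      generalize (∑ j, ∑ k, ψ (‖c t j - c t k‖ ^ 2) * ‖c t j - c t k‖ ^ 2) / 2 = S
      generalize ∑ j, ‖c t j‖ ^ 2 = T
      simp [Complex.mul_re, Complex.mul_im]
    rwa [h2] at h1
  exact is_const_of_deriv_eq_zero (fun t => (hd t).differentiableAt) (fun t => (hd t).deriv) t 0

/-- The pair energy with a potential `g` whose derivative is the profile `ψ` is conserved. -/
theorem sum_pair_conserved {g : ℝ → ℝ} (hc : ∀ t, HasDerivAt c (profileField Ω κ ψ (c t)) t)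
    (hg : ∀ t j k, j ≠ k → HasDerivAt g (ψ (‖c t j - c t k‖ ^ 2)) (‖c t j - c t k‖ ^ 2)) (t : ℝ) :
    (∑ j, ∑ k, if j = k then 0 else g (‖c t j - c t k‖ ^ 2)) =
      ∑ j, ∑ k, if j = k then 0 else g (‖c 0 j - c 0 k‖ ^ 2) := by
  have hd : ∀ t, HasDerivAt
      (fun s => ∑ j, ∑ k, if j = k then 0 else g (‖c s j - c s k‖ ^ 2)) 0 t := by
    intro t
    set X := profileField Ω κ ψ (c t) with hX
    have h1 : HasDerivAt (fun s => ∑ j, ∑ k, if j = k then 0 else g (‖c s j - c s k‖ ^ 2))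
        (∑ j, ∑ k, ψ (‖c t j - c t k‖ ^ 2) * (2 * inner ℝ (c t j - c t k) (X j - X k))) t := by
      refine HasDerivAt.fun_sum fun j _ => HasDerivAt.fun_sum fun k _ => ?_
      by_cases hjk : j = k
      · subst hjk
        simpa using hasDerivAt_const t (0 : ℝ)
      · simp only [if_neg hjk]
        exact (hg t j k hjk).comp t
          ((hasDerivAt_pi.1 (hc t) j).sub (hasDerivAt_pi.1 (hc t) k)).norm_sq
    have h2 : ∑ j, ∑ k, ψ (‖c t j - c t k‖ ^ 2) * (2 * inner ℝ (c t j - c t k) (X j - X k)) =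
        (4 * ∑ j, (starRingEnd ℂ) (interaction ψ (c t) j) * X j).re := by
      have h3 : ((∑ j, ∑ k, ψ (‖c t j - c t k‖ ^ 2) * (2 * inner ℝ (c t j - c t k) (X j - X k)))) =
          (∑ j, ∑ k, (ψ (‖c t j - c t k‖ ^ 2) : ℂ) *
            (2 * (starRingEnd ℂ) (c t j - c t k) * X j)).re +
          (∑ j, ∑ k, (ψ (‖c t j - c t k‖ ^ 2) : ℂ) *
            (2 * (starRingEnd ℂ) (c t k - c t j) * X k)).re := by
        rw [← Complex.add_re]
        simp only [← Finset.sum_add_distrib, Complex.re_sum]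
        refine Finset.sum_congr rfl fun j _ => Finset.sum_congr rfl fun k _ => ?_
        rw [Complex.inner, ← Complex.re_ofReal_mul, ← Complex.re_ofReal_mul]
        congr 1
        simp only [map_sub]
        push_cast
        ring
      rw [h3, Finset.sum_comm (f := fun j k => (ψ (‖c t j - c t k‖ ^ 2) : ℂ) *
            (2 * (starRingEnd ℂ) (c t k - c t j) * X k)), ← Complex.add_re]
      congr 1
      simp only [interaction, map_sum, map_mul, Complex.conj_ofReal, Finset.mul_sum,
        Finset.sum_mul, ← Finset.sum_add_distrib]
      refine Finset.sum_congr rfl fun j _ => Finset.sum_congr rfl fun k _ => ?_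
      rw [norm_sub_rev (c t k)]
      ring
    have h4 : ∑ j, (starRingEnd ℂ) (interaction ψ (c t) j) * X j =
        Complex.I * Ω * (starRingEnd ℂ) (∑ j, (starRingEnd ℂ) (c t j) * interaction ψ (c t) j) +
        Complex.I * κ * ∑ j, ((‖interaction ψ (c t) j‖ ^ 2 : ℝ) : ℂ) := by
      simp only [map_sum, map_mul, Complex.conj_conj, Finset.mul_sum, ← Finset.sum_add_distrib]
      refine Finset.sum_congr rfl fun j _ => ?_
      push_cast
      rw [hX, profileField, ← Complex.conj_mul']
      ring
    rw [h2, h4, sum_conj_mul_interaction, ← Complex.ofReal_sum] at h1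
    convert h1 using 1
    generalize (∑ j, ∑ k, ψ (‖c t j - c t k‖ ^ 2) * ‖c t j - c t k‖ ^ 2) / 2 = S
    generalize ∑ j, ‖interaction ψ (c t) j‖ ^ 2 = T
    simp [Complex.mul_re, Complex.mul_im]
  exact is_const_of_deriv_eq_zero (fun t => (hd t).differentiableAt) (fun t => (hd t).deriv) t 0

theorem vectorField_eq_profileField (Ω γ : ℝ) (z : Fin N → ℂ) :
    vectorField Ω (fun _ => γ) z =
      profileField Ω (γ / (2 * Real.pi)) (fun s => 1 / s) z := by
  funext j
  rw [vectorField, profileField, interaction, ← Finset.add_sum_erase _ _ (Finset.mem_univ j)]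
  simp only [sub_self, mul_zero, zero_add]
  congr 1
  rw [map_mul, map_sum, Finset.mul_sum, Finset.mul_sum]
  refine Finset.sum_congr rfl fun k _ => ?_
  have hpi : (Real.pi : ℂ) ≠ 0 := Complex.ofReal_ne_zero.2 Real.pi_ne_zero
  by_cases h : z j - z k = 0
  · simp [h]
  · have h' : (starRingEnd ℂ) (z j - z k) ≠ 0 := (map_ne_zero _).2 h
    push_cast
    rw [← Complex.conj_mul']
    simp only [map_div₀, map_mul, Complex.conj_ofReal, Complex.conj_I, map_one, map_ofNat]
    field_simp
    rw [Complex.I_sq]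
    ring

theorem IsMotion.sum_normSq_eq {γ : ℝ} (hc : IsMotion Ω (fun _ => γ) c) (t : ℝ) :
    ∑ j, ‖c t j‖ ^ 2 = ∑ j, ‖c 0 j‖ ^ 2 :=
  sum_normSq_conserved (fun t => by
    have := (hc t).2
    rwa [vectorField_eq_profileField] at this) t

/-- Twice the sum, over the pairs, of the logarithms of the squared distances. The diagonal terms
`log 0` are `0`. -/
noncomputable def logEnergy (z : Fin N → ℂ) : ℝ :=
  ∑ j, ∑ k, Real.log (‖z j - z k‖ ^ 2)

theorem logEnergy_eq_ite (z : Fin N → ℂ) :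
    logEnergy z = ∑ j, ∑ k, if j = k then 0 else Real.log (‖z j - z k‖ ^ 2) := by
  refine Finset.sum_congr rfl fun j _ => Finset.sum_congr rfl fun k _ => ?_
  split_ifs with h
  · simp [h]
  · rfl

theorem IsMotion.logEnergy_eq {γ : ℝ} (hc : IsMotion Ω (fun _ => γ) c) (t : ℝ) :
    logEnergy (c t) = logEnergy (c 0) := by
  rw [logEnergy_eq_ite, logEnergy_eq_ite]
  refine sum_pair_conserved (ψ := fun s => 1 / s) (Ω := Ω) (κ := γ / (2 * Real.pi)) ?_ ?_ t
  · intro t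
    have := (hc t).2
    rwa [vectorField_eq_profileField] at this
  · intro t j k hjk
    have h : ‖c t j - c t k‖ ≠ 0 := norm_ne_zero_iff.2 (sub_ne_zero.2 fun h => hjk ((hc t).1 h))
    simpa using Real.hasDerivAt_log (pow_ne_zero 2 h)

end Conservation

/-! ### Existence of motions for all times -/

section Existence

/-- The profile `1 / s` of the point vortices, cut off below `s = ρ²`. -/
noncomputable def cutoffProfile (ρ s : ℝ) : ℝ := 1 / max s (ρ ^ 2)

/-- The potential of `cutoffProfile ρ`: the logarithm, continued linearly below `s = ρ²`. -/
noncomputable def cutoffLog (ρ s : ℝ) : ℝ :=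
  if s ≤ ρ ^ 2 then Real.log (ρ ^ 2) + (s - ρ ^ 2) / ρ ^ 2 else Real.log s

theorem hasDerivAt_cutoffLog {ρ : ℝ} (hρ : 0 < ρ) (s : ℝ) :
    HasDerivAt (cutoffLog ρ) (cutoffProfile ρ s) s := by
  have hm : 0 < ρ ^ 2 := by positivity
  have hlin : ∀ s, HasDerivAt (fun s => Real.log (ρ ^ 2) + (s - ρ ^ 2) / ρ ^ 2) (1 / ρ ^ 2) s :=
    fun s => (((hasDerivAt_id s).sub_const _).div_const _).const_add _
  rcases lt_trichotomy s (ρ ^ 2) with h | h | h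
  · rw [cutoffProfile, max_eq_right h.le]
    refine (hlin s).congr_of_eventuallyEq ?_
    filter_upwards [Iio_mem_nhds h] with x hx
    exact if_pos (le_of_lt hx)
  · subst h
    rw [cutoffProfile, max_self, ← hasDerivWithinAt_univ, ← Set.Iic_union_Ici (a := ρ ^ 2)]
    refine HasDerivWithinAt.union ?_ ?_
    · exact (hlin _).hasDerivWithinAt.congr (fun x hx => if_pos hx) (if_pos le_rfl)
    · have h1 := (Real.hasDerivAt_log hm.ne').hasDerivWithinAt (s := Set.Ici (ρ ^ 2))
      rw [← one_div] at h1
      have h2 : cutoffLog ρ (ρ ^ 2) = Real.log (ρ ^ 2) := by simp [cutoffLog]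
      refine h1.congr (fun x hx => ?_) h2
      rcases eq_or_lt_of_le (Set.mem_Ici.1 hx) with h | h
      · rw [← h, h2]
      · exact if_neg (not_le.2 h)
  · rw [cutoffProfile, max_eq_left h.le, one_div]
    refine (Real.hasDerivAt_log (hm.trans h).ne').congr_of_eventuallyEq ?_
    filter_upwards [Ioi_mem_nhds h] with x hx
    exact if_neg (not_le.2 hx)

theorem max_normSq_eq {ρ : ℝ} (hρ : 0 < ρ) (z : ℂ) :
    max (‖z‖ ^ 2) (ρ ^ 2) = max ‖z‖ ρ ^ 2 := by
  rcases le_total ‖z‖ ρ with h | h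
  · rw [max_eq_right h, max_eq_right (pow_le_pow_left₀ (norm_nonneg z) h 2)]
  · rw [max_eq_left h, max_eq_left (pow_le_pow_left₀ hρ.le h 2)]

theorem norm_cutoff_le {ρ : ℝ} (hρ : 0 < ρ) (z : ℂ) :
    ‖(cutoffProfile ρ (‖z‖ ^ 2) : ℂ) * z‖ ≤ 1 / ρ := by
  have hr : 0 < max ‖z‖ ρ := lt_max_of_lt_right hρ
  rw [cutoffProfile, max_normSq_eq hρ, norm_mul, Complex.norm_real, Real.norm_eq_abs,
    abs_of_pos (by positivity)]
  calc 1 / max ‖z‖ ρ ^ 2 * ‖z‖ ≤ 1 / max ‖z‖ ρ ^ 2 * max ‖z‖ ρ := by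
        gcongr
        exact le_max_left _ _
    _ = 1 / max ‖z‖ ρ := by field_simp
    _ ≤ 1 / ρ := by
        gcongr
        exact le_max_right _ _

/-- The map `z ↦ z / max (|z|, ρ)²` is Lipschitz. -/
theorem norm_cutoff_sub_le {ρ : ℝ} (hρ : 0 < ρ) (x y : ℂ) :
    ‖(cutoffProfile ρ (‖x‖ ^ 2) : ℂ) * x - (cutoffProfile ρ (‖y‖ ^ 2) : ℂ) * y‖ ≤
      3 / ρ ^ 2 * ‖x - y‖ := by
  rw [cutoffProfile, cutoffProfile, max_normSq_eq hρ, max_normSq_eq hρ]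
  set r := max ‖x‖ ρ with hr
  set t := max ‖y‖ ρ with ht
  have hr1 : ρ ≤ r := le_max_right _ _
  have ht1 : ρ ≤ t := le_max_right _ _
  have hy : ‖y‖ ≤ t := le_max_left _ _
  have hr0 : 0 < r := hρ.trans_le hr1
  have ht0 : 0 < t := hρ.trans_le ht1
  have hrt : |t - r| ≤ ‖x - y‖ := by
    rw [abs_sub_comm]
    exact (abs_max_sub_max_le_abs ‖x‖ ‖y‖ ρ).trans (abs_norm_sub_norm_le x y)
  have e : ((1 / r ^ 2 : ℝ) : ℂ) * x - ((1 / t ^ 2 : ℝ) : ℂ) * y =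
      ((1 / r ^ 2 : ℝ) : ℂ) * (x - y) + (((t - r) * (1 / (r ^ 2 * t) + 1 / (r * t ^ 2)) : ℝ) : ℂ) *
        y := by
    have hr' : (r : ℂ) ≠ 0 := Complex.ofReal_ne_zero.2 hr0.ne'
    have ht' : (t : ℂ) ≠ 0 := Complex.ofReal_ne_zero.2 ht0.ne'
    push_cast
    field_simp
    ring
  rw [e]
  refine (norm_add_le _ _).trans ?_
  rw [norm_mul, norm_mul, Complex.norm_real, Complex.norm_real, Real.norm_eq_abs,
    Real.norm_eq_abs, abs_mul, abs_of_pos (a := 1 / r ^ 2) (by positivity),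
    abs_of_pos (a := 1 / (r ^ 2 * t) + 1 / (r * t ^ 2)) (by positivity)]
  have h1 : 1 / r ^ 2 ≤ 1 / ρ ^ 2 := by gcongr
  have h2 : (1 / (r ^ 2 * t) + 1 / (r * t ^ 2)) * ‖y‖ ≤ 2 / ρ ^ 2 := by
    calc (1 / (r ^ 2 * t) + 1 / (r * t ^ 2)) * ‖y‖
        ≤ (1 / (r ^ 2 * t) + 1 / (r * t ^ 2)) * t := by gcongr
      _ = 1 / r ^ 2 + 1 / (r * t) := by field_simp
      _ ≤ 1 / ρ ^ 2 + 1 / (ρ * ρ) := by gcongr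
      _ = 2 / ρ ^ 2 := by field_simp; norm_num
  calc 1 / r ^ 2 * ‖x - y‖ + |t - r| * (1 / (r ^ 2 * t) + 1 / (r * t ^ 2)) * ‖y‖
      = 1 / r ^ 2 * ‖x - y‖ + |t - r| * ((1 / (r ^ 2 * t) + 1 / (r * t ^ 2)) * ‖y‖) := by ring
    _ ≤ 1 / ρ ^ 2 * ‖x - y‖ + ‖x - y‖ * (2 / ρ ^ 2) := by gcongr
    _ = 3 / ρ ^ 2 * ‖x - y‖ := by ring

variable {N : ℕ}

theorem interaction_smul (ψ : ℝ → ℝ) (g : ℂ) (hg : ‖g‖ = 1) (z : Fin N → ℂ) (j : Fin N) :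
    interaction ψ (g • z) j = g * interaction ψ z j := by
  simp only [interaction, Finset.mul_sum, Pi.smul_apply, smul_eq_mul, ← mul_sub, norm_mul, hg,
    one_mul]
  exact Finset.sum_congr rfl fun k _ => by ring

/-- In a frame that rotates with angular velocity `Ω` the field with a cut off profile is bounded
and globally Lipschitz, so its solutions are defined for all times. -/
theorem exists_cutoff_motion (Ω κ : ℝ) {ρ : ℝ} (hρ : 0 < ρ) (y : Fin N → ℂ) :
    ∃ c : ℝ → Fin N → ℂ, c 0 = y ∧
      ∀ t, HasDerivAt c (profileField Ω κ (cutoffProfile ρ) (c t)) t := by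
  set Y : (Fin N → ℂ) → Fin N → ℂ := fun z j =>
    Complex.I * κ * interaction (cutoffProfile ρ) z j with hY
  have hb : ∀ z, ‖Y z‖ ≤ ((|κ| * (N * (1 / ρ))).toNNReal : ℝ) := by
    intro z
    rw [Real.coe_toNNReal _ (by positivity)]
    refine (pi_norm_le_iff_of_nonneg (by positivity)).2 fun j => ?_
    simp only [hY, norm_mul, Complex.norm_I, one_mul, Complex.norm_real, Real.norm_eq_abs]
    refine mul_le_mul_of_nonneg_left ?_ (abs_nonneg κ)
    refine (norm_sum_le _ _).trans ?_
    refine (Finset.sum_le_sum fun k _ => norm_cutoff_le hρ (z j - z k)).trans ?_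
    simp
  have hl : LipschitzWith (|κ| * (N * (3 / ρ ^ 2 * 2))).toNNReal Y := by
    refine LipschitzWith.of_dist_le_mul fun z w => ?_
    rw [dist_eq_norm, dist_eq_norm, Real.coe_toNNReal _ (by positivity)]
    refine (pi_norm_le_iff_of_nonneg (by positivity)).2 fun j => ?_
    simp only [hY, Pi.sub_apply, ← mul_sub, norm_mul, Complex.norm_I, one_mul, Complex.norm_real,
      Real.norm_eq_abs]
    rw [mul_assoc]
    refine mul_le_mul_of_nonneg_left ?_ (abs_nonneg κ)
    rw [interaction, interaction, ← Finset.sum_sub_distrib]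
    refine (norm_sum_le _ _).trans ?_
    have h : ∀ k ∈ Finset.univ, ‖(cutoffProfile ρ (‖z j - z k‖ ^ 2) : ℂ) * (z j - z k) -
        (cutoffProfile ρ (‖w j - w k‖ ^ 2) : ℂ) * (w j - w k)‖ ≤ 3 / ρ ^ 2 * (2 * ‖z - w‖) := by
      intro k _
      refine (norm_cutoff_sub_le hρ _ _).trans ?_
      gcongr
      have e : z j - z k - (w j - w k) = (z - w) j - (z - w) k := by
        simp only [Pi.sub_apply]; ring
      rw [e]
      linarith [norm_sub_le ((z - w) j) ((z - w) k), norm_le_pi_norm (z - w) j,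
        norm_le_pi_norm (z - w) k]
    refine (Finset.sum_le_sum h).trans (le_of_eq ?_)
    simp
    ring
  obtain ⟨w, hw0, hw⟩ := exists_global_integralCurve Y hl hb y
  refine ⟨fun t => Complex.exp (((Ω * t : ℝ) : ℂ) * Complex.I) • w t, by simp [hw0], fun t => ?_⟩
  refine hasDerivAt_pi.2 fun j => ?_
  have h1 : HasDerivAt (fun t : ℝ => Complex.exp (((Ω * t : ℝ) : ℂ) * Complex.I))
      (Complex.exp (((Ω * t : ℝ) : ℂ) * Complex.I) * ((Ω : ℂ) * Complex.I)) t := by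
    have h2 : HasDerivAt (fun t : ℝ => ((Ω * t : ℝ) : ℂ) * Complex.I) ((Ω : ℂ) * Complex.I) t := by
      have h3 : HasDerivAt (fun t : ℝ => Ω * t) Ω t := by
        simpa using (hasDerivAt_id t).const_mul Ω
      exact h3.ofReal_comp.mul_const _
    exact h2.cexp
  refine (h1.fun_mul (hasDerivAt_pi.1 (hw t) j)).congr_deriv ?_
  symm
  change Complex.I * Ω * _ + Complex.I * (κ : ℂ) * interaction _ _ j = _
  rw [interaction_smul _ _ (Complex.norm_exp_ofReal_mul_I _)]
  simp only [hY, Pi.smul_apply, smul_eq_mul]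
  ring

/-- Point vortices of equal strength never collide: conservation of the sum of the squared moduli
bounds all distances from above, so conservation of the energy bounds them from below. The bound
from below holds for a cut off interaction as well, which therefore coincides with the original
one along the solution. -/
theorem exists_motion (Ω γ : ℝ) (y : Fin N → ℂ) (hy : y ∈ phaseSpace N) :
    ∃ c, IsMotion Ω (fun _ : Fin N => γ) c ∧ c 0 = y := by
  set I₀ := ∑ j, ‖y j‖ ^ 2 with hI₀
  have hI₀0 : 0 ≤ I₀ := Finset.sum_nonneg fun j _ => by positivity
  set B := 4 * I₀ + 1 with hB
  have hB1 : 1 ≤ B := by linarith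
  have hlogB : 0 ≤ Real.log B := Real.log_nonneg hB1
  set G₀ := logEnergy y with hG₀
  obtain ⟨ρ₁, hρ₁, hsep⟩ : ∃ ρ₁ > 0, ∀ j k, j ≠ k → ρ₁ < ‖y j - y k‖ := by
    have h : ∀ p : Fin N × Fin N, ∀ᶠ r : ℝ in nhdsWithin 0 (Set.Ioi 0),
        p.1 ≠ p.2 → r < ‖y p.1 - y p.2‖ := by
      intro p
      by_cases hp : p.1 = p.2
      · exact Filter.Eventually.of_forall fun r h => absurd hp h
      · have hpos : 0 < ‖y p.1 - y p.2‖ := norm_pos_iff.2 (sub_ne_zero.2 fun h => hp (hy h))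
        filter_upwards [nhdsWithin_le_nhds (Iio_mem_nhds hpos)] with r hr _ using hr
    obtain ⟨r, hr, hr0⟩ := ((Filter.eventually_all.2 h).and self_mem_nhdsWithin).exists
    exact ⟨r, hr0, fun j k => hr (j, k)⟩
  -- A distance at most `ρ` has `cutoffLog` at most `C`; the other terms are at most `log B`, so the
  -- energy would be less than its initial value `G₀`.
  set C := G₀ - N ^ 2 * Real.log B - 1 with hC
  set ρ := min (min ρ₁ 1) (Real.exp (C / 2)) with hρdef
  have hρ : 0 < ρ := lt_min (lt_min hρ₁ one_pos) (Real.exp_pos _)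
  have hρρ₁ : ρ ≤ ρ₁ := (min_le_left _ _).trans (min_le_left _ _)
  have hρ1 : ρ ≤ 1 := (min_le_left _ _).trans (min_le_right _ _)
  have hlogρ : Real.log (ρ ^ 2) ≤ C := by
    rw [Real.log_pow]
    have := Real.log_le_log hρ (min_le_right (min ρ₁ 1) (Real.exp (C / 2)))
    rw [Real.log_exp] at this
    push_cast
    linarith
  obtain ⟨c, hc0, hc⟩ := exists_cutoff_motion Ω (γ / (2 * Real.pi)) hρ y
  have hI : ∀ t, ∑ j, ‖c t j‖ ^ 2 = I₀ := fun t => by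
    rw [sum_normSq_conserved hc t, hc0]
  have hG : ∀ t, (∑ j, ∑ k, if j = k then 0 else cutoffLog ρ (‖c t j - c t k‖ ^ 2)) = G₀ := by
    intro t
    rw [sum_pair_conserved hc (fun t j k _ => hasDerivAt_cutoffLog hρ _) t, hc0, hG₀,
      logEnergy_eq_ite]
    refine Finset.sum_congr rfl fun j _ => Finset.sum_congr rfl fun k _ => ?_
    split_ifs with h
    · rfl
    · exact if_neg (not_le.2 (pow_lt_pow_left₀ (hρρ₁.trans_lt (hsep j k h)) hρ.le two_ne_zero))
  have hsle : ∀ t j k, ‖c t j - c t k‖ ^ 2 ≤ B := by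
    intro t j k
    have h1 : ‖c t j‖ ^ 2 ≤ I₀ := by
      rw [← hI t]
      exact Finset.single_le_sum (f := fun j => ‖c t j‖ ^ 2) (fun i _ => by positivity)
        (Finset.mem_univ j)
    have h2 : ‖c t k‖ ^ 2 ≤ I₀ := by
      rw [← hI t]
      exact Finset.single_le_sum (f := fun j => ‖c t j‖ ^ 2) (fun i _ => by positivity)
        (Finset.mem_univ k)
    have h3 := norm_sub_le (c t j) (c t k)
    have h4 : ‖c t j - c t k‖ ^ 2 ≤ (‖c t j‖ + ‖c t k‖) ^ 2 :=
      pow_le_pow_left₀ (norm_nonneg _) h3 2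
    nlinarith [sq_nonneg (‖c t j‖ - ‖c t k‖)]
  have hg_small : ∀ s, s ≤ ρ ^ 2 → cutoffLog ρ s ≤ Real.log (ρ ^ 2) := by
    intro s hs
    rw [cutoffLog, if_pos hs]
    have : (s - ρ ^ 2) / ρ ^ 2 ≤ 0 := div_nonpos_of_nonpos_of_nonneg (by linarith) (by positivity)
    linarith
  have hg_le : ∀ s, s ≤ B → cutoffLog ρ s ≤ Real.log B := by
    intro s hs
    by_cases h : s ≤ ρ ^ 2
    · refine (hg_small s h).trans ((Real.log_nonpos (by positivity) ?_).trans hlogB)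
      exact pow_le_one₀ hρ.le hρ1
    · rw [cutoffLog, if_neg h]
      exact Real.log_le_log ((by positivity : (0 : ℝ) < ρ ^ 2).trans (not_le.1 h)) hs
  have hfar : ∀ t j k, j ≠ k → ρ ^ 2 < ‖c t j - c t k‖ ^ 2 := by
    intro t j k hjk
    by_contra hcon
    rw [not_lt] at hcon
    set f : Fin N × Fin N → ℝ := fun p =>
      if p.1 = p.2 then 0 else cutoffLog ρ (‖c t p.1 - c t p.2‖ ^ 2) with hf
    have hfle : ∀ p, f p ≤ Real.log B := by
      intro p
      simp only [hf]
      split_ifs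
      · exact hlogB
      · exact hg_le _ (hsle t _ _)
    have h1 : Real.log B - f (j, k) ≤ ∑ p, (Real.log B - f p) :=
      Finset.single_le_sum (f := fun p => Real.log B - f p)
        (fun p _ => sub_nonneg.2 (hfle p)) (Finset.mem_univ (j, k))
    have h2 : ∑ p, f p = G₀ := by
      rw [← hG t, Fintype.sum_prod_type]
    have h3 : f (j, k) ≤ C := by
      simp only [hf, if_neg hjk]
      exact (hg_small _ hcon).trans hlogρ
    rw [Finset.sum_sub_distrib, h2] at h1
    simp only [Finset.sum_const, Finset.card_univ, Fintype.card_prod, Fintype.card_fin,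
      nsmul_eq_mul, Nat.cast_mul] at h1
    nlinarith
  refine ⟨c, fun t => ⟨fun j k hjk => ?_, ?_⟩, hc0⟩
  · by_contra hne
    have := hfar t j k hne
    rw [hjk, sub_self, norm_zero] at this
    nlinarith
  · rw [vectorField_eq_profileField]
    convert hc t using 1
    funext j
    rw [profileField, profileField, interaction, interaction]
    congr 2
    refine Finset.sum_congr rfl fun k _ => ?_
    by_cases hjk : j = k
    · simp [hjk]
    · rw [cutoffProfile, max_eq_left (hfar t j k hjk).le]

end Existence

/-! ### Pair ratios and their quadratic form -/

section PairRatio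

variable {N : ℕ}

/-- The relative change of the difference `e_j - e_k` of two vertices under the displacement
`e_j ↦ e_j (1 + u_j)`. It is `0` for `j = k`, because of the division by `0`. -/
noncomputable def pairRatio (u : Fin N → ℂ) (j k : Fin N) : ℂ :=
  (unityRoot j * u j - unityRoot k * u k) / (unityRoot j - unityRoot k)

@[simp] theorem pairRatio_self (u : Fin N → ℂ) (j : Fin N) : pairRatio u j j = 0 := by
  simp [pairRatio]

theorem pairRatio_comm (u : Fin N → ℂ) (j k : Fin N) : pairRatio u j k = pairRatio u k j := by
  rw [pairRatio, pairRatio, ← neg_div_neg_eq, neg_sub, neg_sub]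

theorem pairRatio_add (u v : Fin N → ℂ) (j k : Fin N) :
    pairRatio (u + v) j k = pairRatio u j k + pairRatio v j k := by
  simp only [pairRatio, Pi.add_apply]
  ring

theorem pairRatio_sum_mul {ι : Type*} (s : Finset ι) (c : ι → ℂ) (f : ι → Fin N → ℂ)
    (j k : Fin N) :
    pairRatio (fun i => ∑ m ∈ s, c m * f m i) j k = ∑ m ∈ s, c m * pairRatio (f m) j k := by
  simp only [pairRatio, Finset.mul_sum, ← Finset.sum_sub_distrib, Finset.sum_div]
  exact Finset.sum_congr rfl fun m _ => by ring

theorem exists_pairRatio_bound :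
    ∃ D : ℝ, 0 < D ∧ ∀ (u : Fin N → ℂ) (s : ℝ), (∀ j, ‖u j‖ ≤ s) →
      ∀ j k, ‖pairRatio u j k‖ ≤ D * s := by
  refine ⟨∑ p : Fin N × Fin N, 2 / ‖unityRoot p.1 - unityRoot p.2‖ + 1, by positivity,
    fun u s hu j k => ?_⟩
  have hs : 0 ≤ s := (norm_nonneg _).trans (hu j)
  have h1 : ‖pairRatio u j k‖ ≤ 2 / ‖unityRoot j - unityRoot k‖ * s := by
    have : NeZero N := ⟨fun h => (h ▸ j).elim0⟩
    rw [pairRatio, norm_div, div_mul_eq_mul_div]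
    refine div_le_div_of_nonneg_right ?_ (norm_nonneg _)
    refine (norm_sub_le _ _).trans ?_
    rw [norm_mul, norm_mul, norm_unityRoot, norm_unityRoot]
    linarith [hu j, hu k]
  refine h1.trans (mul_le_mul_of_nonneg_right ?_ hs)
  have h2 := Finset.single_le_sum (f := fun p : Fin N × Fin N =>
    2 / ‖unityRoot p.1 - unityRoot p.2‖) (fun p _ => by positivity) (Finset.mem_univ (j, k))
  simp only at h2
  linarith

/-- Summation by parts: in a double sum against a symmetric weight, the pair ratios may be replaced
by one-body terms. -/
theorem sum_mul_pairRatio (g : Fin N → Fin N → ℂ) (hg : ∀ j k, g j k = g k j) (v : Fin N → ℂ) :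
    ∑ j, ∑ k, g j k * pairRatio v j k =
      2 * ∑ j, v j * ∑ k, g j k * (unityRoot j / (unityRoot j - unityRoot k)) := by
  have h1 : ∑ j, ∑ k, g j k * pairRatio v j k =
      ∑ j, ∑ k, v j * (g j k * (unityRoot j / (unityRoot j - unityRoot k))) +
      ∑ j, ∑ k, v k * (g k j * (unityRoot k / (unityRoot k - unityRoot j))) := by
    simp only [← Finset.sum_add_distrib]
    refine Finset.sum_congr rfl fun j _ => Finset.sum_congr rfl fun k _ => ?_
    rw [pairRatio, hg k j, ← neg_sub (unityRoot j) (unityRoot k), div_neg]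
    ring
  rw [h1, Finset.sum_comm (f := fun j k =>
    v k * (g k j * (unityRoot k / (unityRoot k - unityRoot j)))), ← two_mul]
  simp only [Finset.mul_sum]

/-- The complex linear operator of the quadratic form `∑_{j,k} (pairRatio u j k)²`, which is
`2 ∑_j u_j (pairOperator u)_j`. It is diagonal in the Fourier modes. -/
noncomputable def pairOperator (u : Fin N → ℂ) (j : Fin N) : ℂ :=
  ∑ k, pairRatio u j k * (unityRoot j / (unityRoot j - unityRoot k))

theorem sum_pairRatio_mul_pairRatio (u v : Fin N → ℂ) :
    ∑ j, ∑ k, pairRatio u j k * pairRatio v j k = 2 * ∑ j, v j * pairOperator u j :=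
  sum_mul_pairRatio _ (pairRatio_comm u) v

variable [NeZero N]

theorem unityRoot_div_sub (j r : Fin N) :
    unityRoot j / (unityRoot j - unityRoot (j + r)) = 1 / (1 - unityRoot r) := by
  rw [unityRoot_add, ← mul_one_sub, div_mul_eq_div_div, div_self (unityRoot_ne_zero j)]

theorem sum_unityRoot_div_sub (j : Fin N) :
    ∑ k : Fin N, unityRoot j / (unityRoot j - unityRoot k) = ((N : ℂ) - 1) / 2 := by
  rw [sum_shift j]
  simp only [unityRoot_div_sub, sum_inv_one_sub]

theorem sum_pairRatio (u : Fin N → ℂ) :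
    ∑ j, ∑ k, pairRatio u j k = ((N : ℂ) - 1) * ∑ j, u j := by
  have h := sum_mul_pairRatio (fun _ _ => 1) (fun _ _ => rfl) u
  simp only [one_mul, sum_unityRoot_div_sub, ← Finset.sum_mul] at h
  rw [h]
  ring

theorem pairRatio_mode (m : ℕ) (j r : Fin N) :
    pairRatio (fun i => unityRoot i ^ m) j (j + r) =
      unityRoot j ^ m * ((1 - unityRoot r ^ (m + 1)) / (1 - unityRoot r)) := by
  have h : unityRoot j * unityRoot j ^ m - unityRoot j * unityRoot r *
      (unityRoot j * unityRoot r) ^ m =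
      unityRoot j * (unityRoot j ^ m * (1 - unityRoot r ^ (m + 1))) := by ring
  rw [pairRatio, unityRoot_add, h, ← mul_one_sub,
    mul_div_mul_left _ _ (unityRoot_ne_zero j), mul_div_assoc]

theorem pairOperator_mode (m : ℕ) (hm : m < N) (j : Fin N) :
    pairOperator (fun i => unityRoot i ^ m) j = modeEigenvalue N m * unityRoot j ^ m := by
  rw [pairOperator, sum_shift j]
  simp only [pairRatio_mode, unityRoot_div_sub, mul_assoc, ← Finset.mul_sum]
  rw [← sum_modeEigenvalue m hm, mul_comm]
  congr 1
  exact Finset.sum_congr rfl fun r _ => by ring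

theorem pairOperator_eq_fourier (u : Fin N → ℂ) (j : Fin N) :
    pairOperator u j =
      ∑ m : Fin N, fourierCoeff u m * (modeEigenvalue N m * unityRoot j ^ (m : ℕ)) := by
  have hu : u = fun i => ∑ m : Fin N, fourierCoeff u m * unityRoot i ^ (m : ℕ) := by
    funext i
    rw [sum_fourierCoeff_mul]
  have h : ∀ k, pairRatio u j k =
      ∑ m : Fin N, fourierCoeff u m * pairRatio (fun i => unityRoot i ^ (m : ℕ)) j k := by
    intro k
    conv_lhs => rw [hu]
    exact pairRatio_sum_mul _ _ (fun (m : Fin N) i => unityRoot i ^ (m : ℕ)) j k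
  simp only [pairOperator, h, Finset.sum_mul]
  rw [Finset.sum_comm]
  refine Finset.sum_congr rfl fun m _ => ?_
  rw [← pairOperator_mode m m.2 j, pairOperator, Finset.mul_sum]
  exact Finset.sum_congr rfl fun k _ => by ring

theorem sum_mul_unityRoot_pow (u : Fin N → ℂ) (m : Fin N) :
    ∑ j, u j * unityRoot j ^ (m : ℕ) = N * fourierCoeff u (-m) := by
  have hN := natCast_ne_zero_of_neZero (N := N)
  rw [fourierCoeff]
  simp only [unityRoot_pow_neg_val, Complex.conj_conj]
  field_simp

theorem sum_pairRatio_sq (u : Fin N → ℂ) :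
    ∑ j, ∑ k, pairRatio u j k ^ 2 =
      2 * N * ∑ m : Fin N, modeEigenvalue N m * (fourierCoeff u m * fourierCoeff u (-m)) := by
  simp only [sq]
  rw [sum_pairRatio_mul_pairRatio]
  simp only [pairOperator_eq_fourier, Finset.mul_sum]
  rw [Finset.sum_comm]
  refine Finset.sum_congr rfl fun m _ => ?_
  calc _ = 2 * (modeEigenvalue N m * fourierCoeff u m) * ∑ j, u j * unityRoot j ^ (m : ℕ) := by
        rw [Finset.mul_sum]
        exact Finset.sum_congr rfl fun j _ => by ring
    _ = _ := by
        rw [sum_mul_unityRoot_pow]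
        ring

end PairRatio

/-! ### Bounds for the logarithm -/

section LogBounds

/-- The Taylor expansion of `log |1 + w|² = 2 Re log (1 + w)` to the second order. -/
theorem log_normSq_one_add_le_cubic {w : ℂ} (hw : ‖w‖ ≤ 1 / 2) :
    Real.log (‖1 + w‖ ^ 2) ≤ (2 * w - w ^ 2).re + 4 / 3 * ‖w‖ ^ 3 := by
  have h := Complex.norm_log_sub_logTaylor_le 2 (z := w) (by linarith)
  have hT : Complex.logTaylor (2 + 1) w = w - w ^ 2 / 2 := by
    simp [Complex.logTaylor_succ, Complex.logTaylor_zero]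
    ring
  have h1 : (1 - ‖w‖)⁻¹ ≤ 2 := inv_le_of_inv_le₀ two_pos (by linarith)
  have h2 := (Complex.re_le_norm _).trans h
  rw [hT, Complex.sub_re, Complex.log_re] at h2
  have h3 : ‖w‖ ^ (2 + 1) * (1 - ‖w‖)⁻¹ / ((2 : ℕ) + 1) ≤ ‖w‖ ^ 3 * 2 / 3 := by
    norm_num
    gcongr
  have h4 : (2 * w - w ^ 2).re = 2 * (w - w ^ 2 / 2).re := by
    rw [← Complex.re_ofReal_mul]
    congr 1
    push_cast
    ring
  rw [Real.log_pow, h4]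
  push_cast
  linarith

/-- The Taylor expansion of `log |1 + w|² = 2 Re log (1 + w)` to the fourth order. -/
theorem log_normSq_one_add_le_quintic {w : ℂ} (hw : ‖w‖ ≤ 1 / 2) :
    Real.log (‖1 + w‖ ^ 2) ≤
      (2 * w - w ^ 2 + 2 / 3 * w ^ 3 - w ^ 4 / 2).re + 4 / 5 * ‖w‖ ^ 5 := by
  have h := Complex.norm_log_sub_logTaylor_le 4 (z := w) (by linarith)
  have hT : Complex.logTaylor (4 + 1) w = w - w ^ 2 / 2 + w ^ 3 / 3 - w ^ 4 / 4 := by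
    simp [Complex.logTaylor_succ, Complex.logTaylor_zero]
    ring
  have h1 : (1 - ‖w‖)⁻¹ ≤ 2 := inv_le_of_inv_le₀ two_pos (by linarith)
  have h2 := (Complex.re_le_norm _).trans h
  rw [hT, Complex.sub_re, Complex.log_re] at h2
  have h3 : ‖w‖ ^ (4 + 1) * (1 - ‖w‖)⁻¹ / ((4 : ℕ) + 1) ≤ ‖w‖ ^ 5 * 2 / 5 := by
    norm_num
    gcongr
  have h4 : (2 * w - w ^ 2 + 2 / 3 * w ^ 3 - w ^ 4 / 2).re =
      2 * (w - w ^ 2 / 2 + w ^ 3 / 3 - w ^ 4 / 4).re := by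
    rw [← Complex.re_ofReal_mul]
    congr 1
    push_cast
    ring
  rw [Real.log_pow, h4]
  push_cast
  linarith

theorem sub_sq_le_log_one_add {x : ℝ} (hx : 0 ≤ x) : x - x ^ 2 / 2 ≤ Real.log (1 + x) := by
  refine le_trans ?_ (Real.le_log_one_add_of_nonneg hx)
  rw [le_div_iff₀ (by linarith)]
  nlinarith [pow_nonneg hx 3]

end LogBounds

/-! ### The relative energy of at most six vertices -/

section Energy

variable {N : ℕ}

/-- The energy of the displacement `e_j ↦ e_j (1 + u_j)` of the polygon relative to that of the
polygon, normalised so as to be invariant under dilations when `∑ u_j = 0`. -/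
noncomputable def relativeEnergy (u : Fin N → ℂ) : ℝ :=
  ∑ j, ∑ k, Real.log (‖1 + pairRatio u j k‖ ^ 2) -
    N * (N - 1) * Real.log (1 + (∑ j, ‖u j‖ ^ 2) / N)

theorem norm_le_sqrt_sum (u : Fin N → ℂ) (j : Fin N) : ‖u j‖ ≤ √(∑ j, ‖u j‖ ^ 2) :=
  Real.le_sqrt_of_sq_le (Finset.single_le_sum (f := fun j => ‖u j‖ ^ 2)
    (fun _ _ => by positivity) (Finset.mem_univ j))

/-- The forms below couple the modes `m` and `-m`; the coupling is bounded by the diagonal part. -/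
theorem sum_norm_mul_neg_le (l : Fin N → ℝ) (hl : ∀ m, 0 ≤ l m) (hneg : ∀ m, l (-m) = l m)
    (c : Fin N → ℂ) :
    ∑ m, l m * ‖c m * c (-m)‖ ≤ ∑ m, l m * ‖c m‖ ^ 2 := by
  have h1 : ∑ m, l m * ‖c (-m)‖ ^ 2 = ∑ m, l m * ‖c m‖ ^ 2 := by
    rw [← Equiv.sum_comp (Equiv.neg (Fin N)) (fun m => l m * ‖c m‖ ^ 2)]
    exact Finset.sum_congr rfl fun m _ => by simp [hneg]
  have h2 : ∑ m, l m * ‖c m * c (-m)‖ ≤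
      ∑ m, (l m * ‖c m‖ ^ 2 / 2 + l m * ‖c (-m)‖ ^ 2 / 2) := by
    refine Finset.sum_le_sum fun m _ => ?_
    rw [norm_mul]
    nlinarith [mul_nonneg (hl m) (sq_nonneg (‖c m‖ - ‖c (-m)‖))]
  rw [Finset.sum_add_distrib, ← Finset.sum_div, ← Finset.sum_div, h1] at h2
  linarith

variable [NeZero N]

theorem modeEigenvalue_neg (m : Fin N) :
    modeEigenvalue N ((-m : Fin N) : ℕ) = modeEigenvalue N m := by
  by_cases h : m = 0
  · simp [h]
  · have h1 : ((-m : Fin N) : ℕ) = N - m := by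
      rw [Fin.val_neg, if_neg h]
    rw [h1, modeEigenvalue, modeEigenvalue, Nat.cast_sub m.2.le]
    ring

theorem abs_modeEigenvalue_le {N n : ℕ} (hN : N ≤ 6) (h1 : 1 ≤ n) (h2 : n < N) :
    |2 * modeEigenvalue N n| ≤ N - 2 := by
  rw [modeEigenvalue, abs_le]
  interval_cases N <;> first | omega | (interval_cases n <;> norm_num)

/-- At most six vertices: the quadratic part of the energy is definite, as `2 |λ_m| ≤ N - 2` for the
eigenvalues `λ_m = modeEigenvalue N m` with `m ≠ 0`. -/
theorem quadratic_part_pos (hN : N ≤ 6) (u : Fin N → ℂ) (hu : ∑ j, u j = 0) :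
    ∑ j, ‖u j‖ ^ 2 ≤ (∑ j, ∑ k, pairRatio u j k ^ 2).re + (N - 1) * ∑ j, ‖u j‖ ^ 2 := by
  set c := fourierCoeff u with hc
  have hc0 : c 0 = 0 := fourierCoeff_zero u hu
  have hN0 : (0 : ℝ) ≤ N := Nat.cast_nonneg N
  have h1 : -∑ m : Fin N, |2 * modeEigenvalue N m| * ‖c m * c (-m)‖ ≤
      (2 * ∑ m : Fin N, modeEigenvalue N m * (c m * c (-m))).re := by
    rw [Finset.mul_sum, Complex.re_sum, ← Finset.sum_neg_distrib]
    refine Finset.sum_le_sum fun m _ => ?_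
    have h2 : (2 * (modeEigenvalue N m * (c m * c (-m)))).re =
        2 * modeEigenvalue N m * (c m * c (-m)).re := by
      rw [← Complex.re_ofReal_mul]
      congr 1
      push_cast
      ring
    rw [h2]
    refine (neg_le_neg ?_).trans (neg_abs_le _)
    rw [abs_mul]
    exact mul_le_mul_of_nonneg_left (Complex.abs_re_le_norm _) (abs_nonneg _)
  have h2 := sum_norm_mul_neg_le (fun m : Fin N => |2 * modeEigenvalue N m|)
    (fun m => abs_nonneg _) (fun m => by rw [modeEigenvalue_neg]) c
  have h3 : ∑ m : Fin N, |2 * modeEigenvalue N m| * ‖c m‖ ^ 2 ≤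
      ∑ m, ((N : ℝ) - 2) * ‖c m‖ ^ 2 := by
    refine Finset.sum_le_sum fun m _ => ?_
    by_cases hm : m = 0
    · simp [hm, hc0]
    · refine mul_le_mul_of_nonneg_right ?_ (by positivity)
      have hm1 : 1 ≤ (m : ℕ) := Nat.one_le_iff_ne_zero.2 fun h => hm (Fin.ext h)
      exact abs_modeEigenvalue_le hN hm1 m.2
  rw [← Finset.mul_sum] at h3
  rw [sum_pairRatio_sq, sum_normSq_eq_fourierCoeff, mul_comm (2 : ℂ), mul_assoc,
    ← Complex.ofReal_natCast, Complex.re_ofReal_mul]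
  nlinarith

/-- At most six vertices: the definite quadratic part dominates the cubic remainder. -/
theorem relativeEnergy_le_of_le_six (hN : N ≤ 6) :
    ∃ κ > 0, ∃ η > 0, ∀ u : Fin N → ℂ, ∑ j, u j = 0 → ∑ j, ‖u j‖ ^ 2 ≤ η →
      relativeEnergy u ≤ -κ * (∑ j, ‖u j‖ ^ 2) ^ 2 := by
  obtain ⟨D, hD, hDb⟩ := exists_pairRatio_bound (N := N)
  have hN0 : (1 : ℝ) ≤ N := Nat.one_le_cast.2 (NeZero.one_le)
  set C := (N : ℝ) ^ 2 * (4 / 3 * D ^ 3) + N with hC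
  have hC0 : 0 < C := by positivity
  refine ⟨1 / 2, by norm_num, (min (1 / (2 * D)) (min 1 (1 / (2 * C)))) ^ 2, by positivity,
    fun u hu hsmall => ?_⟩
  set n := ∑ j, ‖u j‖ ^ 2 with hn
  have hn0 : 0 ≤ n := Finset.sum_nonneg fun j _ => by positivity
  set s := √n with hs
  have hs0 : 0 ≤ s := Real.sqrt_nonneg n
  have hns : n = s ^ 2 := (Real.sq_sqrt hn0).symm
  have hsle : s ≤ min (1 / (2 * D)) (min 1 (1 / (2 * C))) := by
    rw [hs]
    exact Real.sqrt_le_iff.2 ⟨by positivity, hsmall⟩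
  have hsD : s ≤ 1 / (2 * D) := hsle.trans (min_le_left _ _)
  have hs1 : s ≤ 1 := hsle.trans ((min_le_right _ _).trans (min_le_left _ _))
  have hsC : s ≤ 1 / (2 * C) := hsle.trans ((min_le_right _ _).trans (min_le_right _ _))
  have hw : ∀ j k, ‖pairRatio u j k‖ ≤ D * s := hDb u s (norm_le_sqrt_sum u)
  have hDs : D * s ≤ 1 / 2 := by
    calc D * s ≤ D * (1 / (2 * D)) := by gcongr
      _ = 1 / 2 := by field_simp
  have hCs : C * s ≤ 1 / 2 := by
    calc C * s ≤ C * (1 / (2 * C)) := by gcongr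
      _ = 1 / 2 := by field_simp
  have h1 : ∑ j, ∑ k, Real.log (‖1 + pairRatio u j k‖ ^ 2) ≤
      -(∑ j, ∑ k, pairRatio u j k ^ 2).re + N ^ 2 * (4 / 3 * (D * s) ^ 3) := by
    calc ∑ j, ∑ k, Real.log (‖1 + pairRatio u j k‖ ^ 2)
        ≤ ∑ j, ∑ k, ((2 * pairRatio u j k - pairRatio u j k ^ 2).re + 4 / 3 * (D * s) ^ 3) := by
          refine Finset.sum_le_sum fun j _ => Finset.sum_le_sum fun k _ => ?_
          refine (log_normSq_one_add_le_cubic ((hw j k).trans hDs)).trans ?_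
          gcongr
          exact hw j k
      _ = (2 * ∑ j, ∑ k, pairRatio u j k - ∑ j, ∑ k, pairRatio u j k ^ 2).re +
            N ^ 2 * (4 / 3 * (D * s) ^ 3) := by
          simp only [Finset.sum_add_distrib, ← Complex.re_sum, Finset.sum_sub_distrib,
            ← Finset.mul_sum]
          simp
          ring
      _ = _ := by
          rw [sum_pairRatio, hu]
          simp
  have h2 := quadratic_part_pos hN u hu
  rw [← hn] at h2
  have h3 := sub_sq_le_log_one_add (x := n / N) (by positivity)
  have h4 : (N : ℝ) * (N - 1) * (n / N - (n / N) ^ 2 / 2) ≤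
      N * (N - 1) * Real.log (1 + n / N) :=
    mul_le_mul_of_nonneg_left h3 (mul_nonneg (by positivity) (by linarith))
  have h5 : (N : ℝ) * (N - 1) * (n / N - (n / N) ^ 2 / 2) =
      (N - 1) * n - (N - 1) / (2 * N) * n ^ 2 := by
    field_simp
  have h6 : ((N : ℝ) - 1) / (2 * N) * n ^ 2 ≤ N * s ^ 3 := by
    have : ((N : ℝ) - 1) / (2 * N) ≤ N := by
      rw [div_le_iff₀ (by positivity)]
      nlinarith
    calc ((N : ℝ) - 1) / (2 * N) * n ^ 2 ≤ N * n ^ 2 := by gcongr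
      _ = N * (s ^ 3 * s) := by rw [hns]; ring
      _ ≤ N * (s ^ 3 * 1) := by gcongr
      _ = N * s ^ 3 := by ring
  have h7 : C * s ^ 3 ≤ 1 / 2 * s ^ 2 := by
    calc C * s ^ 3 = C * s * s ^ 2 := by ring
      _ ≤ 1 / 2 * s ^ 2 := by gcongr
  have h8 : n ^ 2 ≤ s ^ 2 := by
    rw [hns]
    have : s ^ 2 ≤ 1 := pow_le_one₀ hs0 hs1
    nlinarith [sq_nonneg s]
  have h9 : C * s ^ 3 = N ^ 2 * (4 / 3 * (D * s) ^ 3) + N * s ^ 3 := by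
    rw [hC]
    ring
  rw [relativeEnergy, ← hn]
  linarith

end Energy

/-! ### The relative energy of the heptagon -/

section Heptagon

/-- The displacements in the kernel of the quadratic part of the energy of the heptagon: the real
displacements in the modes `3` and `4`. -/
noncomputable def kernelMode (c : ℂ) (j : Fin 7) : ℂ :=
  c * unityRoot j ^ 3 + (starRingEnd ℂ) c * unityRoot j ^ 4

theorem pairRatio_kernelMode (c : ℂ) (j r : Fin 7) :
    pairRatio (kernelMode c) j (j + r) =
      c * unityRoot j ^ 3 * ((1 - unityRoot r ^ 4) / (1 - unityRoot r)) +
      (starRingEnd ℂ) c * unityRoot j ^ 4 * ((1 - unityRoot r ^ 5) / (1 - unityRoot r)) := by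
  have h3 := pairRatio_mode (N := 7) 3 j r
  have h4 := pairRatio_mode (N := 7) 4 j r
  have e : pairRatio (kernelMode c) j (j + r) =
      c * pairRatio (fun i => unityRoot i ^ 3) j (j + r) +
      (starRingEnd ℂ) c * pairRatio (fun i => unityRoot i ^ 4) j (j + r) := by
    simp only [pairRatio, kernelMode]
    ring
  rw [e, h3, h4]
  ring

theorem sum_pow_seven (l : ℕ) : ∑ j : Fin 7, unityRoot j ^ l = if 7 ∣ l then 7 else 0 := by
  rw [sum_unityRoot_pow]
  norm_num

/-- At `r = 0` the left side is `0`, whereas the geometric sums are `4` and `5`; this is the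
correction `400 = 4² 5²` in the proof. -/
theorem sum_geom_sq_mul_geom_sq : ∑ r : Fin 7, ((1 - unityRoot r ^ 4) / (1 - unityRoot r)) ^ 2 *
    ((1 - unityRoot r ^ 5) / (1 - unityRoot r)) ^ 2 = 34 := by
  have h : ∀ r : Fin 7, ((1 - unityRoot r ^ 4) / (1 - unityRoot r)) ^ 2 *
      ((1 - unityRoot r ^ 5) / (1 - unityRoot r)) ^ 2 =
      (1 + unityRoot r + unityRoot r ^ 2 + unityRoot r ^ 3) ^ 2 *
        (1 + unityRoot r + unityRoot r ^ 2 + unityRoot r ^ 3 + unityRoot r ^ 4) ^ 2 -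
        if r = 0 then 400 else 0 := by
    intro r
    split_ifs with h
    · simp [h]
      norm_num
    · have h5 : 1 - unityRoot r ≠ 0 := sub_ne_zero.2 (unityRoot_ne_one h).symm
      have hA : (1 - unityRoot r ^ 4) / (1 - unityRoot r) =
          1 + unityRoot r + unityRoot r ^ 2 + unityRoot r ^ 3 := by
        field_simp
        ring
      have hB : (1 - unityRoot r ^ 5) / (1 - unityRoot r) =
          1 + unityRoot r + unityRoot r ^ 2 + unityRoot r ^ 3 + unityRoot r ^ 4 := by
        field_simp
        ring
      rw [hA, hB, sub_zero]
  have e : ∀ x : ℂ, (1 + x + x ^ 2 + x ^ 3) ^ 2 * (1 + x + x ^ 2 + x ^ 3 + x ^ 4) ^ 2 =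
      x ^ 0 + 4 * x ^ 1 + 10 * x ^ 2 + 20 * x ^ 3 + 33 * x ^ 4 + 46 * x ^ 5 + 56 * x ^ 6 +
      60 * x ^ 7 + 56 * x ^ 8 + 46 * x ^ 9 + 33 * x ^ 10 + 20 * x ^ 11 + 10 * x ^ 12 +
      4 * x ^ 13 + x ^ 14 := by
    intro x
    ring
  simp only [h, e, Finset.sum_sub_distrib, Finset.sum_add_distrib, ← Finset.mul_sum,
    sum_pow_seven]
  norm_num

/-- With `A(ω) = 1 + ω + ω² + ω³`, the quotient of `A(ω)² - 16` by `ω - 1` is the polynomial of the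
proof; `48` is its value at `ω = 1`. -/
theorem sum_geom_sq_div_three : ∑ r : Fin 7,
    ((1 - unityRoot r ^ 4) / (1 - unityRoot r)) ^ 2 * (1 / (1 - unityRoot r)) = -9 := by
  have h : ∀ r : Fin 7,
      ((1 - unityRoot r ^ 4) / (1 - unityRoot r)) ^ 2 * (1 / (1 - unityRoot r)) =
      16 * (1 / (1 - unityRoot r)) - (15 * unityRoot r ^ 0 + 13 * unityRoot r ^ 1 +
        10 * unityRoot r ^ 2 + 6 * unityRoot r ^ 3 + 3 * unityRoot r ^ 4 + unityRoot r ^ 5) +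
        if r = 0 then 48 else 0 := by
    intro r
    split_ifs with h
    · simp [h]
      norm_num
    · have h5 : 1 - unityRoot r ≠ 0 := sub_ne_zero.2 (unityRoot_ne_one h).symm
      field_simp
      ring
  simp only [h, Finset.sum_sub_distrib, Finset.sum_add_distrib, ← Finset.mul_sum, sum_pow_seven,
    sum_inv_one_sub]
  norm_num

/-- With `B(ω) = 1 + ω + ω² + ω³ + ω⁴`, the quotient of `B(ω)² - 25` by `ω - 1` is the polynomial of
the proof; `100` is its value at `ω = 1`. -/
theorem sum_geom_sq_div_four : ∑ r : Fin 7,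
    ((1 - unityRoot r ^ 5) / (1 - unityRoot r)) ^ 2 * (1 / (1 - unityRoot r)) = 0 := by
  have h : ∀ r : Fin 7,
      ((1 - unityRoot r ^ 5) / (1 - unityRoot r)) ^ 2 * (1 / (1 - unityRoot r)) =
      25 * (1 / (1 - unityRoot r)) - (24 * unityRoot r ^ 0 + 22 * unityRoot r ^ 1 +
        19 * unityRoot r ^ 2 + 15 * unityRoot r ^ 3 + 10 * unityRoot r ^ 4 +
        6 * unityRoot r ^ 5 + 3 * unityRoot r ^ 6 + unityRoot r ^ 7) +
        if r = 0 then 100 else 0 := by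
    intro r
    split_ifs with h
    · simp [h]
      norm_num
    · have h5 : 1 - unityRoot r ≠ 0 := sub_ne_zero.2 (unityRoot_ne_one h).symm
      field_simp
      ring
  simp only [h, Finset.sum_sub_distrib, Finset.sum_add_distrib, ← Finset.mul_sum, sum_pow_seven,
    sum_inv_one_sub]
  norm_num

/-- The cube contains the modes `9, 10, 11, 12` only, none of which is divisible by `7`. -/
theorem sum_kernelMode_cube (c : ℂ) : ∑ j, ∑ k, pairRatio (kernelMode c) j k ^ 3 = 0 := by
  have h : ∀ j, ∑ k, pairRatio (kernelMode c) j k ^ 3 =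
      ∑ r, pairRatio (kernelMode c) j (j + r) ^ 3 := fun j => sum_shift j _
  simp only [h, pairRatio_kernelMode]
  rw [Finset.sum_comm]
  refine Finset.sum_eq_zero fun r _ => ?_
  generalize (1 - unityRoot r ^ 4) / (1 - unityRoot r) = A
  generalize (1 - unityRoot r ^ 5) / (1 - unityRoot r) = B
  generalize (starRingEnd ℂ) c = d
  have e : ∀ j : Fin 7, (c * unityRoot j ^ 3 * A + d * unityRoot j ^ 4 * B) ^ 3 =
      (c * A) ^ 3 * unityRoot j ^ 9 + 3 * (c * A) ^ 2 * (d * B) * unityRoot j ^ 10 +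
      3 * (c * A) * (d * B) ^ 2 * unityRoot j ^ 11 + (d * B) ^ 3 * unityRoot j ^ 12 := by
    intro j
    ring
  simp only [e, Finset.sum_add_distrib, ← Finset.mul_sum, sum_pow_seven]
  norm_num

/-- Of the modes `12, …, 16` of the fourth power only the mode `14` contributes. -/
theorem sum_kernelMode_fourth (c : ℂ) :
    ∑ j, ∑ k, pairRatio (kernelMode c) j k ^ 4 = ((1428 * ‖c‖ ^ 4 : ℝ) : ℂ) := by
  have h : ∀ j, ∑ k, pairRatio (kernelMode c) j k ^ 4 =
      ∑ r, pairRatio (kernelMode c) j (j + r) ^ 4 := fun j => sum_shift j _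
  simp only [h, pairRatio_kernelMode]
  rw [Finset.sum_comm]
  have e : ∀ (j : Fin 7) (d A B : ℂ), (c * unityRoot j ^ 3 * A + d * unityRoot j ^ 4 * B) ^ 4 =
      (c * A) ^ 4 * unityRoot j ^ 12 + 4 * (c * A) ^ 3 * (d * B) * unityRoot j ^ 13 +
      6 * (c * A) ^ 2 * (d * B) ^ 2 * unityRoot j ^ 14 +
      4 * (c * A) * (d * B) ^ 3 * unityRoot j ^ 15 + (d * B) ^ 4 * unityRoot j ^ 16 := by
    intro j d A B
    ring
  have h2 : ∀ r : Fin 7, ∑ j : Fin 7,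
      (c * unityRoot j ^ 3 * ((1 - unityRoot r ^ 4) / (1 - unityRoot r)) +
      (starRingEnd ℂ) c * unityRoot j ^ 4 * ((1 - unityRoot r ^ 5) / (1 - unityRoot r))) ^ 4 =
      42 * ((starRingEnd ℂ) c * c) ^ 2 * (((1 - unityRoot r ^ 4) / (1 - unityRoot r)) ^ 2 *
        ((1 - unityRoot r ^ 5) / (1 - unityRoot r)) ^ 2) := by
    intro r
    simp only [e, Finset.sum_add_distrib, ← Finset.mul_sum, sum_pow_seven]
    norm_num
    ring
  simp only [h2, ← Finset.mul_sum, sum_geom_sq_mul_geom_sq]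
  rw [Complex.conj_mul']
  push_cast
  ring

/-- The cubic interaction of the kernel with a displacement `o` sees only the mode `1` of `o`. -/
theorem sum_kernelMode_sq_mul (c : ℂ) (o : Fin 7 → ℂ) (ho : ∑ j, o j = 0) :
    ∑ j, ∑ k, pairRatio (kernelMode c) j k ^ 2 * pairRatio o j k =
      -18 * c ^ 2 * ∑ j, o j * unityRoot j ^ 6 := by
  rw [sum_mul_pairRatio _ (fun j k => by rw [pairRatio_comm])]
  have h : ∀ j, ∑ k, pairRatio (kernelMode c) j k ^ 2 *
      (unityRoot j / (unityRoot j - unityRoot k)) = -9 * c ^ 2 * unityRoot j ^ 6 +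
      2 * c * (starRingEnd ℂ) c * ∑ r : Fin 7, ((1 - unityRoot r ^ 4) / (1 - unityRoot r)) *
        ((1 - unityRoot r ^ 5) / (1 - unityRoot r)) * (1 / (1 - unityRoot r)) := by
    intro j
    rw [sum_shift j]
    simp only [pairRatio_kernelMode, unityRoot_div_sub]
    have e : ∀ (d A B C : ℂ), (c * unityRoot j ^ 3 * A + d * unityRoot j ^ 4 * B) ^ 2 * C =
        c ^ 2 * unityRoot j ^ 6 * (A ^ 2 * C) + 2 * c * d * unityRoot j ^ 7 * (A * B * C) +
        d ^ 2 * unityRoot j ^ 8 * (B ^ 2 * C) := by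
      intro d A B C
      ring
    simp only [e, Finset.sum_add_distrib, ← Finset.mul_sum, sum_geom_sq_div_three,
      sum_geom_sq_div_four, unityRoot_pow_card]
    ring
  simp only [h, mul_add, Finset.sum_add_distrib, ← Finset.sum_mul, ho, zero_mul, add_zero]
  simp only [Finset.mul_sum]
  exact Finset.sum_congr rfl fun j _ => by ring

/-- The Taylor polynomial of `log |1 + K + O|²`, where terms of weight more than `4` are estimated:
here `K` has weight `1` and `O` has weight `2`. -/
theorem log_normSq_le_weighted {K O : ℂ} {M t s : ℝ} (hM : 0 < M) (ht : 0 ≤ t) (hs : 0 ≤ s)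
    (hK : ‖K‖ ≤ M * t) (hO : ‖O‖ ≤ M * s) (hsmall : M * (t + s) ≤ 1 / 2) (hts : t + s ≤ 1) :
    Real.log (‖1 + (K + O)‖ ^ 2) ≤
      (2 * (K + O) - (K + O) ^ 2 + (2 / 3 * K ^ 3 + 2 * (K ^ 2 * O)) - K ^ 4 / 2).re +
        (3 * M ^ 3 + 8 * M ^ 4 + 7 * M ^ 5) * ((t + s) * (s ^ 2 + t ^ 4)) := by
  have hw : ‖K + O‖ ≤ M * (t + s) := by linarith [norm_add_le K O]
  have h1 := log_normSq_one_add_le_quintic (hw.trans hsmall)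
  set R := 2 * (K * O ^ 2) + 2 / 3 * O ^ 3 - (2 * (K ^ 3 * O) + 3 * (K ^ 2 * O ^ 2) +
    2 * (K * O ^ 3) + 1 / 2 * O ^ 4) with hR
  have h2 : 2 * (K + O) - (K + O) ^ 2 + 2 / 3 * (K + O) ^ 3 - (K + O) ^ 4 / 2 =
      (2 * (K + O) - (K + O) ^ 2 + (2 / 3 * K ^ 3 + 2 * (K ^ 2 * O)) - K ^ 4 / 2) + R := by
    rw [hR]
    ring
  rw [h2, Complex.add_re] at h1
  set q := s ^ 2 + t ^ 4 with hq
  have hq0 : 0 ≤ q := by positivity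
  set ε := t + s with hε
  have hε0 : 0 ≤ ε := add_nonneg ht hs
  have htε : t ≤ ε := by linarith
  have hsε : s ≤ ε := by linarith
  have ht1 : t ≤ 1 := by linarith
  have hs1 : s ≤ 1 := by linarith
  have hsq : s ^ 2 ≤ q := by
    rw [hq]
    linarith [pow_nonneg ht 4]
  have htq : t ^ 4 ≤ q := by
    rw [hq]
    linarith [pow_nonneg hs 2]
  have htsq : t ^ 2 * s ≤ q := by nlinarith [sq_nonneg (t ^ 2 - s), pow_nonneg ht 4]
  have b1 : t * s ^ 2 ≤ ε * q := mul_le_mul htε hsq (by positivity) hε0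
  have b2 : s ^ 3 ≤ ε * q := by
    calc s ^ 3 = s * s ^ 2 := by ring
      _ ≤ ε * q := mul_le_mul hsε hsq (by positivity) hε0
  have b3 : t ^ 3 * s ≤ ε * q := by
    calc t ^ 3 * s = t * (t ^ 2 * s) := by ring
      _ ≤ ε * q := mul_le_mul htε htsq (by positivity) hε0
  have b4 : t ^ 2 * s ^ 2 ≤ ε * q := by
    calc t ^ 2 * s ^ 2 = t * (t * s ^ 2) := by ring
      _ ≤ 1 * (t * s ^ 2) := by gcongr
      _ ≤ ε * q := by rw [one_mul]; exact b1
  have b5 : t * s ^ 3 ≤ ε * q := by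
    calc t * s ^ 3 ≤ 1 * s ^ 3 := by gcongr
      _ ≤ ε * q := by rw [one_mul]; exact b2
  have b6 : s ^ 4 ≤ ε * q := by
    calc s ^ 4 = s * s ^ 3 := by ring
      _ ≤ 1 * s ^ 3 := by gcongr
      _ ≤ ε * q := by rw [one_mul]; exact b2
  have b7 : ε ^ 5 ≤ 8 * (ε * q) := by
    have h4 : s ^ 4 ≤ s ^ 2 := pow_le_pow_of_le_one hs hs1 (by norm_num)
    have h8 : ε ^ 4 ≤ 8 * q := by
      have h9 : ε ^ 4 ≤ 8 * (t ^ 4 + s ^ 4) := by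
        have := add_pow_le ht hs 4
        norm_num at this
        rw [hε]
        linarith
      rw [hq]
      linarith
    calc ε ^ 5 = ε * ε ^ 4 := by ring
      _ ≤ ε * (8 * q) := by gcongr
      _ = _ := by ring
  have hw5 : ‖K + O‖ ^ 5 ≤ 8 * M ^ 5 * (ε * q) := by
    calc ‖K + O‖ ^ 5 ≤ (M * ε) ^ 5 := by gcongr
      _ = M ^ 5 * ε ^ 5 := by ring
      _ ≤ M ^ 5 * (8 * (ε * q)) := by gcongr
      _ = _ := by ring
  have hRn : ‖R‖ ≤ 2 * (M ^ 3 * (t * s ^ 2)) + 2 / 3 * (M ^ 3 * s ^ 3) +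
      (2 * (M ^ 4 * (t ^ 3 * s)) + 3 * (M ^ 4 * (t ^ 2 * s ^ 2)) + 2 * (M ^ 4 * (t * s ^ 3)) +
        1 / 2 * (M ^ 4 * s ^ 4)) := by
    have g : ∀ a b : ℕ, ‖K ^ a * O ^ b‖ ≤ (M * t) ^ a * (M * s) ^ b := by
      intro a b
      rw [norm_mul, norm_pow, norm_pow]
      gcongr
    have g1 := g 1 2
    have g2 := g 0 3
    have g3 := g 3 1
    have g4 := g 2 2
    have g5 := g 1 3
    have g6 := g 0 4
    simp only [pow_one, pow_zero, one_mul] at g1 g2 g3 g4 g5 g6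
    rw [hR]
    refine (norm_sub_le _ _).trans (add_le_add ?_ ?_)
    · refine (norm_add_le _ _).trans (add_le_add ?_ ?_)
      · rw [norm_mul, Complex.norm_ofNat]
        linarith
      · rw [norm_mul, norm_div, Complex.norm_ofNat, Complex.norm_ofNat]
        linarith
    · refine (norm_add_le _ _).trans (add_le_add ((norm_add_le _ _).trans
        (add_le_add ((norm_add_le _ _).trans (add_le_add ?_ ?_)) ?_)) ?_)
      · rw [norm_mul, Complex.norm_ofNat]
        linarith
      · rw [norm_mul, Complex.norm_ofNat]
        linarith
      · rw [norm_mul, Complex.norm_ofNat]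
        linarith
      · rw [norm_mul, norm_div, norm_one, Complex.norm_ofNat]
        linarith
  have hRe := (Complex.re_le_norm R).trans hRn
  have hM3 : 0 ≤ M ^ 3 := by positivity
  have hM4 : 0 ≤ M ^ 4 := by positivity
  have c1 := mul_le_mul_of_nonneg_left b1 hM3
  have c2 := mul_le_mul_of_nonneg_left b2 hM3
  have c3 := mul_le_mul_of_nonneg_left b3 hM4
  have c4 := mul_le_mul_of_nonneg_left b4 hM4
  have c5 := mul_le_mul_of_nonneg_left b5 hM4
  have c6 := mul_le_mul_of_nonneg_left b6 hM4
  have c7 : 0 ≤ M ^ 5 * (ε * q) := by positivity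
  have c8 : 0 ≤ M ^ 3 * (ε * q) := by positivity
  have c9 : 0 ≤ M ^ 4 * (ε * q) := by positivity
  linarith

theorem modeEigenvalue_seven : modeEigenvalue 7 1 = 0 ∧ modeEigenvalue 7 2 = -2 ∧
    modeEigenvalue 7 3 = -3 ∧ modeEigenvalue 7 4 = -3 ∧ modeEigenvalue 7 5 = -2 ∧
    modeEigenvalue 7 6 = 0 := by
  refine ⟨?_, ?_, ?_, ?_, ?_, ?_⟩ <;> (rw [modeEigenvalue]; norm_num)

theorem sum_kernelMode_mul_pow (c : ℂ) (m : ℕ) (h1 : ¬ 7 ∣ 3 + m) (h2 : ¬ 7 ∣ 4 + m) :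
    ∑ j, kernelMode c j * unityRoot j ^ m = 0 := by
  simp only [kernelMode, add_mul, mul_assoc, ← pow_add, Finset.sum_add_distrib,
    ← Finset.mul_sum, sum_pow_seven, if_neg h1, if_neg h2]
  simp

theorem sum_pairRatio_sq_seven (u : Fin 7 → ℂ) (hu : ∑ j, u j = 0) :
    (∑ j, ∑ k, pairRatio u j k ^ 2).re =
      -(56 * (fourierCoeff u 2 * fourierCoeff u 5).re +
        84 * (fourierCoeff u 3 * fourierCoeff u 4).re) := by
  obtain ⟨l1, l2, l3, l4, l5, l6⟩ := modeEigenvalue_seven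
  have ha0 : fourierCoeff u 0 = 0 := fourierCoeff_zero u hu
  have e : ∑ j, ∑ k, pairRatio u j k ^ 2 =
      -(((56 : ℝ) : ℂ) * (fourierCoeff u 2 * fourierCoeff u 5) +
        ((84 : ℝ) : ℂ) * (fourierCoeff u 3 * fourierCoeff u 4)) := by
    rw [sum_pairRatio_sq, Fin.sum_univ_seven]
    have n1 : (-1 : Fin 7) = 6 := rfl
    have n2 : (-2 : Fin 7) = 5 := rfl
    have n3 : (-3 : Fin 7) = 4 := rfl
    have n4 : (-4 : Fin 7) = 3 := rfl
    have n5 : (-5 : Fin 7) = 2 := rfl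
    have n6 : (-6 : Fin 7) = 1 := rfl
    have v1 : ((1 : Fin 7) : ℕ) = 1 := rfl
    have v2 : ((2 : Fin 7) : ℕ) = 2 := rfl
    have v3 : ((3 : Fin 7) : ℕ) = 3 := rfl
    have v4 : ((4 : Fin 7) : ℕ) = 4 := rfl
    have v5 : ((5 : Fin 7) : ℕ) = 5 := rfl
    have v6 : ((6 : Fin 7) : ℕ) = 6 := rfl
    rw [n1, n2, n3, n4, n5, n6, v1, v2, v3, v4, v5, v6, l1, l2, l3, l4, l5, l6, ha0]
    push_cast
    ring
  rw [e, Complex.neg_re, Complex.add_re, Complex.re_ofReal_mul, Complex.re_ofReal_mul]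

/-- A displacement of the heptagon splits into a displacement `kernelMode c`, which the quadratic
part of the energy does not see, and a complement `o` of size `s`, on which that part is negative
definite. The coefficient of `o` in the mode `1` is `a`. -/
theorem exists_kernelMode_decomposition (u : Fin 7 → ℂ) (hu : ∑ j, u j = 0) :
    ∃ (c a : ℂ) (o : Fin 7 → ℂ) (s : ℝ), 0 ≤ s ∧ u = kernelMode c + o ∧ ∑ j, o j = 0 ∧
      ∑ j, o j * unityRoot j ^ 6 = 7 * a ∧ (∀ j, ‖o j‖ ≤ 6 * s) ∧ ‖a‖ ^ 2 ≤ s ^ 2 ∧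
      14 * ‖c‖ ^ 2 + 7 * s ^ 2 ≤ ∑ j, ‖u j‖ ^ 2 ∧
      ∑ j, ‖u j‖ ^ 2 ≤ 14 * (‖c‖ ^ 2 + s ^ 2) ∧
      -(∑ j, ∑ k, pairRatio u j k ^ 2).re - 6 * ∑ j, ‖u j‖ ^ 2 ≤ -28 * ‖a‖ ^ 2 - 14 * s ^ 2 := by
  set a := fourierCoeff u with ha
  have ha0 : a 0 = 0 := fourierCoeff_zero u hu
  have hquad := sum_pairRatio_sq_seven u hu
  -- The modes `3` and `4` split into the kernel, where `a 4 = conj (a 3)`, and its complement,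
  -- where `a 4 = -conj (a 3)`.
  set c := (a 3 + (starRingEnd ℂ) (a 4)) / 2 with hc
  set d := (a 3 - (starRingEnd ℂ) (a 4)) / 2 with hd
  have ha3 : a 3 = c + d := by
    rw [hc, hd]
    ring
  have ha4 : a 4 = (starRingEnd ℂ) (c - d) := by
    rw [hc, hd, ← sub_div]
    simp
  have hpar : ‖a 3‖ ^ 2 + ‖a 4‖ ^ 2 = 2 * ‖c‖ ^ 2 + 2 * ‖d‖ ^ 2 := by
    rw [ha3, ha4, RCLike.norm_conj]
    have := parallelogram_law_with_norm ℝ c d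
    linarith
  have h34 : (a 3 * a 4).re = ‖c‖ ^ 2 - ‖d‖ ^ 2 := by
    rw [ha3, ha4, Complex.sq_norm, Complex.sq_norm, Complex.normSq_apply,
      Complex.normSq_apply]
    simp
    ring
  have h25 : (a 2 * a 5).re ≤ (‖a 2‖ ^ 2 + ‖a 5‖ ^ 2) / 2 := by
    refine (Complex.re_le_norm _).trans ?_
    rw [norm_mul]
    linarith [two_mul_le_add_sq ‖a 2‖ ‖a 5‖]
  have hn : ∑ j, ‖u j‖ ^ 2 = 7 * (‖a 1‖ ^ 2 + ‖a 2‖ ^ 2 + ‖a 5‖ ^ 2 + ‖a 6‖ ^ 2 + 2 * ‖c‖ ^ 2 +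
      2 * ‖d‖ ^ 2) := by
    rw [sum_normSq_eq_fourierCoeff, Fin.sum_univ_seven, ← ha, ha0, norm_zero]
    push_cast
    linarith
  set P := ‖a 1‖ ^ 2 + ‖a 2‖ ^ 2 + ‖a 5‖ ^ 2 + ‖a 6‖ ^ 2 + ‖d‖ ^ 2 with hP
  have p1 := sq_nonneg ‖a 1‖
  have p2 := sq_nonneg ‖a 2‖
  have p5 := sq_nonneg ‖a 5‖
  have p6 := sq_nonneg ‖a 6‖
  have pd := sq_nonneg ‖d‖
  have hsP : √P ^ 2 = P := Real.sq_sqrt (by linarith)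
  have hle_s : ∀ x : ℝ, x ^ 2 ≤ P → x ≤ √P := fun x hx => Real.le_sqrt_of_sq_le hx
  refine ⟨c, a 1, fun j => u j - kernelMode c j, √P, Real.sqrt_nonneg P, ?_, ?_, ?_, ?_, ?_, ?_,
    ?_, ?_⟩
  · funext j
    simp
  · have h := sum_kernelMode_mul_pow c 0 (by norm_num) (by norm_num)
    simp only [pow_zero, mul_one] at h
    simp only [Finset.sum_sub_distrib, hu, h, sub_zero]
  · have h := sum_kernelMode_mul_pow c 6 (by norm_num) (by norm_num)
    simp only [sub_mul, Finset.sum_sub_distrib, h, sub_zero]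
    exact sum_mul_unityRoot_pow u (6 : Fin 7)
  · intro j
    have hu_apply : u j = a 1 * unityRoot j + a 2 * unityRoot j ^ 2 + a 3 * unityRoot j ^ 3 +
        a 4 * unityRoot j ^ 4 + a 5 * unityRoot j ^ 5 + a 6 * unityRoot j ^ 6 := by
      rw [← sum_fourierCoeff_mul u j, Fin.sum_univ_seven, ← ha, ha0, zero_mul, zero_add]
      simp
    have ho_apply : u j - kernelMode c j = a 1 * unityRoot j + a 2 * unityRoot j ^ 2 +
        a 5 * unityRoot j ^ 5 + a 6 * unityRoot j ^ 6 +
        (d * unityRoot j ^ 3 - (starRingEnd ℂ) d * unityRoot j ^ 4) := by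
      rw [hu_apply, ha3, ha4, kernelMode, map_sub]
      ring
    have hx : ∀ (b : ℂ) (k : ℕ), ‖b * unityRoot j ^ k‖ = ‖b‖ := by
      intro b k
      rw [norm_mul, norm_pow, norm_unityRoot, one_pow, mul_one]
    have s1 : ‖a 1‖ ≤ √P := hle_s _ (by linarith)
    have s2 : ‖a 2‖ ≤ √P := hle_s _ (by linarith)
    have s5 : ‖a 5‖ ≤ √P := hle_s _ (by linarith)
    have s6 : ‖a 6‖ ≤ √P := hle_s _ (by linarith)
    have sd : ‖d‖ ≤ √P := hle_s _ (by linarith)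
    have x1 := hx (a 1) 1
    have x4 := hx ((starRingEnd ℂ) d) 4
    rw [pow_one] at x1
    rw [RCLike.norm_conj] at x4
    beta_reduce
    rw [ho_apply]
    refine (norm_add_le _ _).trans ?_
    have y1 := norm_add_le (a 1 * unityRoot j + a 2 * unityRoot j ^ 2 + a 5 * unityRoot j ^ 5)
      (a 6 * unityRoot j ^ 6)
    have y2 := norm_add_le (a 1 * unityRoot j + a 2 * unityRoot j ^ 2) (a 5 * unityRoot j ^ 5)
    have y3 := norm_add_le (a 1 * unityRoot j) (a 2 * unityRoot j ^ 2)
    have y4 := norm_sub_le (d * unityRoot j ^ 3) ((starRingEnd ℂ) d * unityRoot j ^ 4)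
    linarith [hx (a 2) 2, hx (a 5) 5, hx (a 6) 6, hx d 3]
  · rw [hsP]
    linarith
  · rw [hsP, hn]
    linarith
  · rw [hsP, hn]
    linarith
  · rw [hsP, hn, hquad, h34]
    linarith

/-- The energy of the pairs near the heptagon, up to terms of weight more than `4`. -/
theorem sum_log_le_seven (c : ℂ) (o : Fin 7 → ℂ) (ho : ∑ j, o j = 0) {M s : ℝ} (hM : 0 < M)
    (hs : 0 ≤ s) (hK : ∀ j k, ‖pairRatio (kernelMode c) j k‖ ≤ M * ‖c‖)
    (hO : ∀ j k, ‖pairRatio o j k‖ ≤ M * s) (hsmall : M * (‖c‖ + s) ≤ 1 / 2)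
    (hts : ‖c‖ + s ≤ 1) :
    ∑ j, ∑ k, Real.log (‖1 + pairRatio (kernelMode c + o) j k‖ ^ 2) ≤
      -(∑ j, ∑ k, pairRatio (kernelMode c + o) j k ^ 2).re -
        36 * (c ^ 2 * ∑ j, o j * unityRoot j ^ 6).re - 714 * ‖c‖ ^ 4 +
        49 * ((3 * M ^ 3 + 8 * M ^ 4 + 7 * M ^ 5) * ((‖c‖ + s) * (s ^ 2 + ‖c‖ ^ 4))) := by
  set C := (3 * M ^ 3 + 8 * M ^ 4 + 7 * M ^ 5) * ((‖c‖ + s) * (s ^ 2 + ‖c‖ ^ 4)) with hC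
  set u := kernelMode c + o with hu
  have hu0 : ∑ j, u j = 0 := by
    have h := sum_kernelMode_mul_pow c 0 (by norm_num) (by norm_num)
    simp only [pow_zero, mul_one] at h
    simp [hu, Finset.sum_add_distrib, ho, h]
  calc ∑ j, ∑ k, Real.log (‖1 + pairRatio u j k‖ ^ 2)
      ≤ ∑ j, ∑ k, ((2 * pairRatio u j k - pairRatio u j k ^ 2 +
          (2 / 3 * pairRatio (kernelMode c) j k ^ 3 +
            2 * (pairRatio (kernelMode c) j k ^ 2 * pairRatio o j k)) -
          pairRatio (kernelMode c) j k ^ 4 / 2).re + C) := by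
        refine Finset.sum_le_sum fun j _ => Finset.sum_le_sum fun k _ => ?_
        rw [hu, pairRatio_add]
        exact log_normSq_le_weighted hM (norm_nonneg c) hs (hK j k) (hO j k) hsmall hts
    _ = (2 * ∑ j, ∑ k, pairRatio u j k - ∑ j, ∑ k, pairRatio u j k ^ 2 +
          (2 / 3 * ∑ j, ∑ k, pairRatio (kernelMode c) j k ^ 3 +
            2 * ∑ j, ∑ k, pairRatio (kernelMode c) j k ^ 2 * pairRatio o j k) -
          (∑ j, ∑ k, pairRatio (kernelMode c) j k ^ 4) / 2).re + 49 * C := by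
        simp only [Finset.sum_add_distrib, ← Complex.re_sum, Finset.sum_sub_distrib,
          ← Finset.mul_sum, ← Finset.sum_div, Finset.sum_const, Finset.card_univ,
          Fintype.card_fin, nsmul_eq_mul]
        push_cast
        ring
    _ = _ := by
        rw [sum_pairRatio, hu0, sum_kernelMode_cube, sum_kernelMode_fourth,
          sum_kernelMode_sq_mul c o ho]
        generalize ∑ j, ∑ k, pairRatio u j k ^ 2 = Q
        generalize ∑ j, o j * unityRoot j ^ 6 = S
        have e : (2 * (((7 : ℕ) - 1 : ℂ) * 0) - Q +
            (2 / 3 * 0 + 2 * (-18 * c ^ 2 * S)) - ((1428 * ‖c‖ ^ 4 : ℝ) : ℂ) / 2) =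
            -Q - ((36 : ℝ) : ℂ) * (c ^ 2 * S) - ((714 * ‖c‖ ^ 4 : ℝ) : ℂ) := by
          push_cast
          ring
        rw [e, Complex.sub_re, Complex.sub_re, Complex.neg_re, Complex.re_ofReal_mul,
          Complex.ofReal_re]

/-- The heptagon: the quadratic part of the energy is degenerate exactly on the two-dimensional
kernel of `kernelMode`. There the cubic part vanishes; the quartic part, reduced by the largest
possible contribution of the cubic coupling with the mode `1`, is negative definite. -/
theorem relativeEnergy_le_of_eq_seven :
    ∃ κ > 0, ∃ η > 0, ∀ u : Fin 7 → ℂ, ∑ j, u j = 0 → ∑ j, ‖u j‖ ^ 2 ≤ η →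
      relativeEnergy u ≤ -κ * (∑ j, ‖u j‖ ^ 2) ^ 2 := by
  obtain ⟨D, hD, hDb⟩ := exists_pairRatio_bound (N := 7)
  set M := 6 * D with hM
  have hM0 : 0 < M := by positivity
  set C := 3 * M ^ 3 + 8 * M ^ 4 + 7 * M ^ 5 with hC
  have hC0 : 0 < C := by positivity
  refine ⟨1 / 392, by norm_num, (min (1 / (4 * M)) (min (1 / 2) (1 / (2 * (49 * C + 252))))) ^ 2,
    by positivity, fun u hu hsmall => ?_⟩
  obtain ⟨c, a, o, s, hs0, huo, ho, ho_one, ho_norm, has, hnt, hnle, hquad⟩ :=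
    exists_kernelMode_decomposition u hu
  set n := ∑ j, ‖u j‖ ^ 2 with hn
  have hn0 : 0 ≤ n := Finset.sum_nonneg fun j _ => by positivity
  have hsle : √n ≤ min (1 / (4 * M)) (min (1 / 2) (1 / (2 * (49 * C + 252)))) :=
    Real.sqrt_le_iff.2 ⟨by positivity, hsmall⟩
  have hk_norm : ∀ j, ‖kernelMode c j‖ ≤ 2 * ‖c‖ := by
    intro j
    refine (norm_add_le _ _).trans ?_
    simp only [norm_mul, norm_pow, norm_unityRoot, one_pow, mul_one, RCLike.norm_conj]
    linarith
  have hK : ∀ j k, ‖pairRatio (kernelMode c) j k‖ ≤ M * ‖c‖ := by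
    intro j k
    refine (hDb _ _ hk_norm j k).trans ?_
    have := mul_nonneg hD.le (norm_nonneg c)
    rw [hM]
    linarith
  have hO : ∀ j k, ‖pairRatio o j k‖ ≤ M * s := by
    intro j k
    refine (hDb _ _ ho_norm j k).trans (le_of_eq ?_)
    rw [hM]
    ring
  have hlogs := sum_log_le_seven c o ho hM0 hs0 hK hO
  rw [← huo, ho_one] at hlogs
  have ht0 : 0 ≤ ‖c‖ := norm_nonneg c
  -- The cubic coupling is split so that `36 ‖a‖²` is absorbed by the quadratic part
  -- `28 ‖a‖² + 14 s²`, as `‖a‖ ≤ s`, and `441 ‖c‖⁴`, together with the `84 ‖c‖⁴` from the inertia,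
  -- by the quartic part `714 ‖c‖⁴`.
  have hcub : -252 * (c ^ 2 * a).re ≤ 36 * ‖a‖ ^ 2 + 441 * ‖c‖ ^ 4 := by
    have h := (abs_le.1 (Complex.abs_re_le_norm (c ^ 2 * a))).1
    rw [norm_mul, norm_pow] at h
    have h2 := sq_nonneg (6 * ‖a‖ - 21 * ‖c‖ ^ 2)
    linarith
  have hcub' : 36 * (c ^ 2 * (7 * a)).re = 252 * (c ^ 2 * a).re := by
    have e : c ^ 2 * (7 * a) = ((7 : ℝ) : ℂ) * (c ^ 2 * a) := by
      push_cast
      ring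
    rw [e, Complex.re_ofReal_mul]
    ring
  rw [hcub'] at hlogs
  have hlog := sub_sq_le_log_one_add (x := n / 7) (by positivity)
  have hE : relativeEnergy u = ∑ j, ∑ k, Real.log (‖1 + pairRatio u j k‖ ^ 2) -
      42 * Real.log (1 + n / 7) := by
    rw [relativeEnergy, ← hn]
    norm_num
  clear_value n C
  clear hDb hK hO ho_one ho_norm hk_norm huo ho hcub'
  generalize ‖c‖ = t at *
  have htn : t ≤ √n := Real.le_sqrt_of_sq_le (by linarith [sq_nonneg s, sq_nonneg t])
  have hsn : s ≤ √n := Real.le_sqrt_of_sq_le (by linarith [sq_nonneg s, sq_nonneg t])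
  have hts1 : t + s ≤ 1 := by
    have := hsle.trans ((min_le_right _ _).trans (min_le_left _ _))
    linarith
  have htsM : M * (t + s) ≤ 1 / 2 := by
    calc M * (t + s) ≤ M * (2 * (1 / (4 * M))) := by
          gcongr
          linarith [hsle.trans (min_le_left _ _)]
      _ = 1 / 2 := by
          field_simp
          norm_num
  have htsC : (49 * C + 252) * (t + s) ≤ 1 := by
    calc (49 * C + 252) * (t + s) ≤ (49 * C + 252) * (2 * (1 / (2 * (49 * C + 252)))) := by
          gcongr
          linarith [hsle.trans ((min_le_right _ _).trans (min_le_right _ _))]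
      _ = 1 := by field_simp
  have h1 := hlogs htsM hts1
  rw [← hC] at h1
  set q := s ^ 2 + t ^ 4 with hq
  have hq0 : 0 ≤ q := by positivity
  have ht1 : t ≤ 1 := by linarith
  have hs1 : s ≤ 1 := by linarith
  have ht2 : t ^ 2 ≤ t := pow_le_of_le_one ht0 ht1 two_ne_zero
  have hs2 : s ^ 2 ≤ s := pow_le_of_le_one hs0 hs1 two_ne_zero
  have hsq : s ^ 2 ≤ q := by
    rw [hq]
    linarith [pow_nonneg ht0 4]
  have e1 : t ^ 2 * s ^ 2 ≤ (t + s) * q :=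
    mul_le_mul (by linarith) hsq (by positivity) (by positivity)
  have e2 : s ^ 2 * s ^ 2 ≤ (t + s) * q :=
    mul_le_mul (by linarith) hsq (by positivity) (by positivity)
  have h4 : s ^ 4 ≤ s ^ 2 := pow_le_pow_of_le_one hs0 hs1 (by norm_num)
  have h5 : 0 ≤ (s ^ 2 - t ^ 2) ^ 2 := sq_nonneg _
  have hn2 : n ^ 2 ≤ (14 * (t ^ 2 + s ^ 2)) ^ 2 := pow_le_pow_left₀ hn0 hnle 2
  have hCe : (49 * C + 252) * ((t + s) * q) ≤ q := by
    calc (49 * C + 252) * ((t + s) * q) = ((49 * C + 252) * (t + s)) * q := by ring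
      _ ≤ 1 * q := by gcongr
      _ = q := one_mul q
  have hn3 : 3 / 7 * n ^ 2 ≤ 84 * t ^ 4 + 252 * ((t + s) * q) := by linarith
  have hfinal : relativeEnergy u ≤ -q := by
    rw [hE]
    linarith
  have hnq : n ^ 2 ≤ 392 * q := by
    rw [hq]
    linarith
  linarith

/-- The regular polygon with at most seven vertices is a strict local maximum of the energy, modulo
rotations and dilations. -/
theorem relativeEnergy_le {N : ℕ} [NeZero N] (hN : N ≤ 7) :
    ∃ κ > 0, ∃ η > 0, ∀ u : Fin N → ℂ, ∑ j, u j = 0 → ∑ j, ‖u j‖ ^ 2 ≤ η →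
      relativeEnergy u ≤ -κ * (∑ j, ‖u j‖ ^ 2) ^ 2 := by
  rcases Nat.lt_or_ge N 7 with h | h
  · exact relativeEnergy_le_of_le_six (Nat.lt_succ_iff.1 h)
  · obtain rfl : N = 7 := le_antisymm hN h
    exact relativeEnergy_le_of_eq_seven

end Heptagon

/-! ### The regular polygon as a relative equilibrium -/

section RelativeEquilibrium

variable {N : ℕ}

theorem regularPolygon_apply (a : ℂ) (j : Fin N) : regularPolygon N a j = a * unityRoot j := rfl

variable [NeZero N]

theorem regularPolygon_injective {a : ℂ} (ha : a ≠ 0) :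
    Function.Injective (regularPolygon N a) := fun _ _ h =>
  unityRoot_injective (mul_left_cancel₀ ha h)

/-- The forces on a vertex add up to a multiple of its position, because
`∑_{r ≠ 0} 1 / (1 - ω_r) = (N - 1) / 2`. -/
theorem interaction_regularPolygon {a : ℂ} (ha : a ≠ 0) (j : Fin N) :
    interaction (fun s => 1 / s) (regularPolygon N a) j =
      (((N - 1) / (2 * ‖a‖ ^ 2) : ℝ) : ℂ) * regularPolygon N a j := by
  have h1 : interaction (fun s => 1 / s) (regularPolygon N a) j =
      (starRingEnd ℂ) ((a * unityRoot j)⁻¹ *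
        ∑ k : Fin N, unityRoot j / (unityRoot j - unityRoot k)) := by
    rw [interaction, Finset.mul_sum, map_sum]
    refine Finset.sum_congr rfl fun k _ => ?_
    rw [regularPolygon_apply, regularPolygon_apply, ← mul_sub]
    by_cases h : unityRoot j - unityRoot k = 0
    · simp [h]
    · have h' : (starRingEnd ℂ) (unityRoot j - unityRoot k) ≠ 0 := (map_ne_zero _).2 h
      have ha' : (starRingEnd ℂ) a ≠ 0 := (map_ne_zero _).2 ha
      have he : (starRingEnd ℂ) (unityRoot j) ≠ 0 := (map_ne_zero _).2 (unityRoot_ne_zero j)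
      push_cast
      rw [← Complex.conj_mul']
      simp only [map_mul, map_div₀, map_inv₀]
      field_simp
  rw [h1, sum_unityRoot_div_sub, regularPolygon_apply]
  have ha' : (starRingEnd ℂ) a ≠ 0 := (map_ne_zero _).2 ha
  push_cast
  rw [← Complex.conj_mul']
  simp only [map_mul, map_div₀, map_inv₀, map_sub, map_one, map_natCast, map_ofNat,
    conj_unityRoot]
  have he := unityRoot_ne_zero j
  field_simp

/-- The angular velocity of the regular polygon. -/
noncomputable def polygonVelocity (N : ℕ) (Ω γ : ℝ) (a : ℂ) : ℝ :=
  Ω + γ / (2 * Real.pi) * ((N - 1) / (2 * ‖a‖ ^ 2))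

theorem isRelativeEquilibrium_regularPolygon (Ω γ : ℝ) {a : ℂ} (ha : a ≠ 0) :
    IsRelativeEquilibrium Ω (fun _ : Fin N => γ) (regularPolygon N a)
      (polygonVelocity N Ω γ a) := by
  set ξ := polygonVelocity N Ω γ a with hξ
  intro t
  refine ⟨fun j k hjk => regularPolygon_injective ha ?_, hasDerivAt_pi.2 fun j => ?_⟩
  · exact mul_left_cancel₀ (Complex.exp_ne_zero _) hjk
  · rw [vectorField_eq_profileField]
    have h1 : HasDerivAt (fun t : ℝ => Complex.exp (((ξ * t : ℝ) : ℂ) * Complex.I))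
        (Complex.exp (((ξ * t : ℝ) : ℂ) * Complex.I) * ((ξ : ℂ) * Complex.I)) t := by
      have h2 : HasDerivAt (fun t : ℝ => ((ξ * t : ℝ) : ℂ) * Complex.I)
          ((ξ : ℂ) * Complex.I) t := by
        have h3 : HasDerivAt (fun t : ℝ => ξ * t) ξ t := by
          simpa using (hasDerivAt_id t).const_mul ξ
        exact h3.ofReal_comp.mul_const _
      exact h2.cexp
    refine (h1.mul_const (regularPolygon N a j)).congr_deriv ?_
    symm
    change Complex.I * Ω * _ + Complex.I * ((γ / (2 * Real.pi) : ℝ) : ℂ) * interaction _ _ j = _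
    rw [interaction_smul _ _ (Complex.norm_exp_ofReal_mul_I _), interaction_regularPolygon ha,
      hξ, polygonVelocity]
    simp only [Pi.smul_apply, smul_eq_mul]
    push_cast
    ring

end RelativeEquilibrium

/-! ### Lyapunov stability -/

section Stability

variable {N : ℕ}

/-- The amplitude of a configuration along the regular polygon with vertex `a`. -/
noncomputable def amplitude (a : ℂ) (z : Fin N → ℂ) : ℂ :=
  (∑ j, z j / (a * unityRoot j)) / N

/-- The deviation of a configuration from a multiple of the regular polygon, in the frames of the
vertices. -/
noncomputable def deviation (a : ℂ) (z : Fin N → ℂ) (j : Fin N) : ℂ :=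
  z j / (a * unityRoot j) - amplitude a z

/-- The sum of the squared moduli, normalised to be `1` at the regular polygon. -/
noncomputable def inertia (a : ℂ) (z : Fin N → ℂ) : ℝ :=
  (∑ j, ‖z j‖ ^ 2) / (N * ‖a‖ ^ 2)

theorem eq_amplitude_add_deviation {a : ℂ} (ha : a ≠ 0) (z : Fin N → ℂ) (j : Fin N) :
    z j = a * unityRoot j * (amplitude a z + deviation a z j) := by
  have := unityRoot_ne_zero j
  rw [deviation, add_sub_cancel]
  field_simp

theorem norm_amplitude_smul (a g : ℂ) (hg : ‖g‖ = 1) (z : Fin N → ℂ) :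
    ‖amplitude a (g • z)‖ = ‖amplitude a z‖ := by
  have h : amplitude a (g • z) = g * amplitude a z := by
    simp only [amplitude, Pi.smul_apply, smul_eq_mul, mul_div_assoc, ← Finset.mul_sum]
  rw [h, norm_mul, hg, one_mul]

theorem inertia_smul (a g : ℂ) (hg : ‖g‖ = 1) (z : Fin N → ℂ) :
    inertia a (g • z) = inertia a z := by
  simp [inertia, hg]

theorem logEnergy_smul (g : ℂ) (hg : ‖g‖ = 1) (z : Fin N → ℂ) :
    logEnergy (g • z) = logEnergy z := by
  simp [logEnergy, ← mul_sub, hg]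

theorem continuousAt_logEnergy {z : Fin N → ℂ} (hz : Function.Injective z) :
    ContinuousAt logEnergy z := by
  refine tendsto_finsetSum _ fun j _ => tendsto_finsetSum _ fun k _ => ?_
  by_cases h : j = k
  · subst h
    simp
  · have h1 : ContinuousAt (fun z : Fin N → ℂ => ‖z j - z k‖ ^ 2) z := by fun_prop
    exact h1.log (pow_ne_zero 2 (norm_ne_zero_iff.2 (sub_ne_zero.2 fun h' => h (hz h'))))

theorem continuous_amplitude (a : ℂ) :
    Continuous (amplitude a : (Fin N → ℂ) → ℂ) := by
  unfold amplitude
  fun_prop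

theorem continuous_inertia (a : ℂ) :
    Continuous (inertia a : (Fin N → ℂ) → ℝ) := by
  unfold inertia
  fun_prop

variable [NeZero N]

theorem sum_deviation (a : ℂ) (z : Fin N → ℂ) : ∑ j, deviation a z j = 0 := by
  have hN := natCast_ne_zero_of_neZero (N := N)
  simp only [deviation, Finset.sum_sub_distrib, Finset.sum_const, Finset.card_univ,
    Fintype.card_fin, nsmul_eq_mul, amplitude]
  field_simp
  simp

/-- The amplitude and the deviation are orthogonal, as the deviation has sum zero. -/
theorem inertia_eq {a : ℂ} (ha : a ≠ 0) (z : Fin N → ℂ) :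
    inertia a z = ‖amplitude a z‖ ^ 2 + (∑ j, ‖deviation a z j‖ ^ 2) / N := by
  have hN : (N : ℝ) ≠ 0 := Nat.cast_ne_zero.2 (NeZero.ne N)
  have ha' : ‖a‖ ≠ 0 := norm_ne_zero_iff.2 ha
  have h1 : ∀ j, ‖z j‖ ^ 2 = ‖a‖ ^ 2 * (‖amplitude a z‖ ^ 2 + ‖deviation a z j‖ ^ 2 +
      2 * ((starRingEnd ℂ) (amplitude a z) * deviation a z j).re) := by
    intro j
    conv_lhs => rw [eq_amplitude_add_deviation ha z j]
    rw [norm_mul, norm_mul, norm_unityRoot, mul_one, mul_pow, norm_add_sq_real, Complex.inner,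
      mul_comm (deviation a z j)]
    ring
  have h2 : ∑ j, ‖z j‖ ^ 2 =
      ‖a‖ ^ 2 * (N * ‖amplitude a z‖ ^ 2 + ∑ j, ‖deviation a z j‖ ^ 2) := by
    simp only [h1, ← Finset.mul_sum, Finset.sum_add_distrib, ← Complex.re_sum, sum_deviation]
    simp
  rw [inertia, h2]
  field_simp

theorem amplitude_regularPolygon {a : ℂ} (ha : a ≠ 0) :
    amplitude a (regularPolygon N a) = 1 := by
  have hN := natCast_ne_zero_of_neZero (N := N)
  have h : ∀ j : Fin N, regularPolygon N a j / (a * unityRoot j) = 1 := fun j =>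
    div_self (mul_ne_zero ha (unityRoot_ne_zero j))
  simp only [amplitude, h]
  simp [hN]

theorem inertia_regularPolygon {a : ℂ} (ha : a ≠ 0) : inertia a (regularPolygon N a) = 1 := by
  have hN : (N : ℝ) ≠ 0 := Nat.cast_ne_zero.2 (NeZero.ne N)
  have ha' : ‖a‖ ≠ 0 := norm_ne_zero_iff.2 ha
  simp only [inertia, regularPolygon_apply, norm_mul, norm_unityRoot, mul_one]
  simp only [Finset.sum_const, Finset.card_univ, Fintype.card_fin, nsmul_eq_mul]
  exact div_self (mul_ne_zero hN (pow_ne_zero 2 ha'))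

/-- The energy, corrected by the inertia so as to be invariant under dilations, is the relative
energy of the displacement from the polygon of the same amplitude. -/
theorem logEnergy_sub_eq {a : ℂ} (ha : a ≠ 0) {z : Fin N → ℂ} (hz : Function.Injective z)
    (hA : amplitude a z ≠ 0) :
    logEnergy z - N * (N - 1) * Real.log (inertia a z) = logEnergy (regularPolygon N a) +
      relativeEnergy (fun j => deviation a z j / amplitude a z) := by
  set A := amplitude a z with hAdef
  set u : Fin N → ℂ := fun j => deviation a z j / A with hu
  have hA0 : ‖A‖ ≠ 0 := norm_ne_zero_iff.2 hA
  have hN : (N : ℝ) ≠ 0 := Nat.cast_ne_zero.2 (NeZero.ne N)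
  have hzj : ∀ j, z j = a * unityRoot j * (A * (1 + u j)) := by
    intro j
    conv_lhs => rw [eq_amplitude_add_deviation ha z j]
    simp only [hu, ← hAdef]
    field_simp
  have hpair : ∀ j k, Real.log (‖z j - z k‖ ^ 2) =
      Real.log (‖regularPolygon N a j - regularPolygon N a k‖ ^ 2) +
      (Real.log (‖A‖ ^ 2) - if j = k then Real.log (‖A‖ ^ 2) else 0) +
      Real.log (‖1 + pairRatio u j k‖ ^ 2) := by
    intro j k
    split_ifs with h
    · simp [h]
    · have hx : regularPolygon N a j - regularPolygon N a k ≠ 0 :=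
        sub_ne_zero.2 fun h' => h (regularPolygon_injective ha h')
      have he : unityRoot j - unityRoot k ≠ 0 := sub_ne_zero.2 fun h' => h (unityRoot_injective h')
      have hd : z j - z k ≠ 0 := sub_ne_zero.2 fun h' => h (hz h')
      have hfac : z j - z k = (regularPolygon N a j - regularPolygon N a k) * A *
          (1 + pairRatio u j k) := by
        rw [hzj j, hzj k, regularPolygon_apply, regularPolygon_apply, pairRatio]
        field_simp
        ring
      have hw : 1 + pairRatio u j k ≠ 0 := by
        intro h0
        rw [h0, mul_zero] at hfac
        exact hd hfac
      rw [hfac, norm_mul, norm_mul, mul_pow, mul_pow, sub_zero,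
        Real.log_mul (mul_ne_zero (pow_ne_zero 2 (norm_ne_zero_iff.2 hx)) (pow_ne_zero 2 hA0))
          (pow_ne_zero 2 (norm_ne_zero_iff.2 hw)),
        Real.log_mul (pow_ne_zero 2 (norm_ne_zero_iff.2 hx)) (pow_ne_zero 2 hA0)]
  have hsum : logEnergy z = logEnergy (regularPolygon N a) + N * (N - 1) * Real.log (‖A‖ ^ 2) +
      ∑ j, ∑ k, Real.log (‖1 + pairRatio u j k‖ ^ 2) := by
    simp only [logEnergy, hpair, Finset.sum_add_distrib, Finset.sum_sub_distrib]
    simp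
    ring
  have hin : inertia a z = ‖A‖ ^ 2 * (1 + (∑ j, ‖u j‖ ^ 2) / N) := by
    rw [inertia_eq ha z, ← hAdef]
    simp only [hu, norm_div, div_pow, ← Finset.sum_div]
    field_simp
  have hpos : (1 + (∑ j, ‖u j‖ ^ 2) / N) ≠ 0 := by positivity
  rw [hin, Real.log_mul (pow_ne_zero 2 hA0) hpos, hsum, relativeEnergy]
  ring

/-- A configuration whose inertia is near `1` and comes almost entirely from the amplitude `A` is
near to the polygon, rotated by the argument of `A`. -/
theorem nearOrbit_of_amplitude {a : ℂ} (ha : a ≠ 0) {z : Fin N → ℂ} {τ ε : ℝ} (hτ0 : 0 ≤ τ)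
    (hτ : τ ≤ 1 / 4) (hε : ‖a‖ * ((2 + √N) * √τ) < ε) (h1 : |inertia a z - 1| ≤ τ)
    (h2 : inertia a z ≤ ‖amplitude a z‖ ^ 2 * (1 + τ)) :
    NearOrbit ε (regularPolygon N a) z := by
  set A := amplitude a z with hA
  set p := ‖A‖ ^ 2 with hp
  have hN : (0 : ℝ) < N := Nat.cast_pos.2 (NeZero.pos N)
  obtain ⟨h1l, h1r⟩ := abs_le.1 h1
  have hin := inertia_eq ha z
  rw [← hA, ← hp] at hin
  have hdev0 : 0 ≤ (∑ j, ‖deviation a z j‖ ^ 2) / N := by positivity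
  have hp0 : 0 ≤ p := by positivity
  have hpu : p ≤ 1 + τ := by linarith
  have hpl : 1 - 2 * τ ≤ p := by nlinarith
  have hAabs : |‖A‖ - 1| ≤ 2 * τ := by
    have h3 : |‖A‖ - 1| ≤ |‖A‖ ^ 2 - 1| := by
      have e : ‖A‖ ^ 2 - 1 = (‖A‖ - 1) * (‖A‖ + 1) := by ring
      rw [e, abs_mul, abs_of_pos (a := ‖A‖ + 1) (by positivity)]
      exact le_mul_of_one_le_right (abs_nonneg _) (by linarith [norm_nonneg A])
    refine h3.trans (abs_le.2 ⟨?_, ?_⟩) <;> linarith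
  have hdev : ∀ j, ‖deviation a z j‖ ≤ √N * √τ := by
    intro j
    rw [← Real.sqrt_mul hN.le]
    refine Real.le_sqrt_of_sq_le ?_
    have h3 : ‖deviation a z j‖ ^ 2 ≤ ∑ j, ‖deviation a z j‖ ^ 2 :=
      Finset.single_le_sum (f := fun j => ‖deviation a z j‖ ^ 2) (fun _ _ => by positivity)
        (Finset.mem_univ j)
    have h4 : (∑ j, ‖deviation a z j‖ ^ 2) / N ≤ τ := by nlinarith
    rw [div_le_iff₀ hN] at h4
    linarith
  have hττ : τ ≤ √τ := Real.le_sqrt_of_sq_le (by nlinarith)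
  refine ⟨Circle.exp (Complex.arg A), ?_⟩
  refine lt_of_le_of_lt ?_ hε
  rw [dist_pi_le_iff (by positivity)]
  intro j
  have hAg : A - (Circle.exp (Complex.arg A) : ℂ) =
      ((‖A‖ - 1 : ℝ) : ℂ) * (Circle.exp (Complex.arg A) : ℂ) := by
    rw [Circle.coe_exp]
    push_cast
    linear_combination -Complex.norm_mul_exp_arg_mul_I A
  have hAg' : ‖A - (Circle.exp (Complex.arg A) : ℂ)‖ ≤ 2 * τ := by
    rw [hAg, norm_mul, Circle.norm_coe, mul_one, Complex.norm_real, Real.norm_eq_abs]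
    exact hAabs
  rw [dist_eq_norm, Pi.smul_apply, smul_eq_mul, regularPolygon_apply,
    eq_amplitude_add_deviation ha z j, ← hA]
  have e : a * unityRoot j * (A + deviation a z j) -
      (Circle.exp (Complex.arg A) : ℂ) * (a * unityRoot j) =
      a * unityRoot j * ((A - (Circle.exp (Complex.arg A) : ℂ)) + deviation a z j) := by ring
  rw [e, norm_mul, norm_mul, norm_unityRoot, mul_one]
  gcongr
  refine (norm_add_le _ _).trans ?_
  linarith [hdev j]

/-- The dilation-invariant energy `V` and the inertia are conserved. Along a motion the ratio
`∑ ‖u_j‖²`, where `u` is the deviation divided by the amplitude, varies continuously; if it reached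
the value `N τ`, then `V` would lie `κ (N τ)²` below its value at the polygon, by
`relativeEnergy_le`. -/
theorem isLyapunovStable_regularPolygon (hN : N ≤ 7) (Ω γ : ℝ) {a : ℂ} (ha : a ≠ 0) :
    IsLyapunovStableModSO2 Ω (fun _ : Fin N => γ) (regularPolygon N a) := by
  intro ε hε
  obtain ⟨κ, hκ, η, hη, hmax⟩ := relativeEnergy_le hN
  have hN0 : (0 : ℝ) < N := Nat.cast_pos.2 (NeZero.pos N)
  have ha0 : 0 < ‖a‖ := norm_pos_iff.2 ha
  set τ := min (min (1 / 4) (η / N)) ((ε / (2 * (‖a‖ * (2 + √N)))) ^ 2) with hτ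
  have hτ0 : 0 < τ := by positivity
  have hτ4 : τ ≤ 1 / 4 := (min_le_left _ _).trans (min_le_left _ _)
  have hτη : N * τ ≤ η := by
    have : τ ≤ η / N := (min_le_left _ _).trans (min_le_right _ _)
    rw [le_div_iff₀ hN0] at this
    linarith
  have hτε : ‖a‖ * ((2 + √N) * √τ) < ε := by
    have h1 : √τ ≤ ε / (2 * (‖a‖ * (2 + √N))) :=
      Real.sqrt_le_iff.2 ⟨by positivity, min_le_right _ _⟩
    calc ‖a‖ * ((2 + √N) * √τ) ≤ ‖a‖ * ((2 + √N) * (ε / (2 * (‖a‖ * (2 + √N))))) := by gcongr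
      _ = ε / 2 := by field_simp
      _ < ε := by linarith
  set x := regularPolygon N a with hx
  have hxinj : Function.Injective x := regularPolygon_injective ha
  set V : (Fin N → ℂ) → ℝ := fun z => logEnergy z - N * (N - 1) * Real.log (inertia a z) with hV
  have hVx : V x = logEnergy x := by simp [hV, hx, inertia_regularPolygon ha]
  -- The conditions on the initial configuration, which are open and invariant under rotations.
  have hopen : ∀ᶠ y in nhds x, logEnergy x - κ * (N * τ) ^ 2 < V y ∧
      inertia a y < ‖amplitude a y‖ ^ 2 * (1 + τ) ∧ |inertia a y - 1| < τ := by
    have c1 : ContinuousAt V x := by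
      refine (continuousAt_logEnergy hxinj).sub (continuousAt_const.mul ?_)
      refine (continuous_inertia a).continuousAt.log ?_
      rw [hx, inertia_regularPolygon ha]
      exact one_ne_zero
    have c2 : ContinuousAt (fun y => ‖amplitude a y‖ ^ 2 * (1 + τ) - inertia a y) x := by
      have := continuous_amplitude (N := N) a
      have := continuous_inertia (N := N) a
      exact Continuous.continuousAt (by fun_prop)
    have c3 : ContinuousAt (fun y => |inertia a y - 1|) x := by
      have := continuous_inertia (N := N) a
      exact Continuous.continuousAt (by fun_prop)
    have e1 := c1.eventually_const_lt (u := logEnergy x - κ * (N * τ) ^ 2) (by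
      rw [hVx]
      have : 0 < κ * (N * τ) ^ 2 := by positivity
      linarith)
    have e2 := c2.eventually_const_lt (u := 0) (by
      beta_reduce
      rw [hx, inertia_regularPolygon ha, amplitude_regularPolygon ha]
      simpa using hτ0)
    have e3 := c3.eventually_lt_const (u := τ) (by
      beta_reduce
      rw [hx, inertia_regularPolygon ha]
      simpa using hτ0)
    filter_upwards [e1, e2, e3] with y h1 h2 h3
    exact ⟨h1, by linarith, h3⟩
  obtain ⟨δ, hδ, hball⟩ := Metric.eventually_nhds_iff.1 hopen
  refine ⟨δ, hδ, fun y hy hnear => ⟨exists_motion Ω γ y hy, fun c hc hc0 => ?_⟩⟩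
  have hyopen : logEnergy x - κ * (N * τ) ^ 2 < V y ∧
      inertia a y < ‖amplitude a y‖ ^ 2 * (1 + τ) ∧ |inertia a y - 1| < τ := by
    obtain ⟨g, hg⟩ := hnear
    have hgi : ‖(g : ℂ)⁻¹‖ = 1 := by rw [norm_inv, Circle.norm_coe, inv_one]
    have h1 : dist ((g : ℂ)⁻¹ • y) x < δ := by
      have e : (g : ℂ)⁻¹ • y - x = (g : ℂ)⁻¹ • (y - (g : ℂ) • x) := by
        rw [smul_sub, smul_smul, inv_mul_cancel₀ (Circle.coe_ne_zero g), one_smul]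
      rw [dist_eq_norm, e, norm_smul, hgi, one_mul, ← dist_eq_norm]
      exact hg
    have h2 := hball h1
    simp only [hV] at h2 ⊢
    rwa [logEnergy_smul _ hgi, inertia_smul _ _ hgi, norm_amplitude_smul _ _ hgi] at h2
  have hin : ∀ t, inertia a (c t) = inertia a y := by
    intro t
    rw [inertia, inertia, hc.sum_normSq_eq t, hc0]
  have hVc : ∀ t, V (c t) = V y := by
    intro t
    simp only [hV]
    rw [hin t, hc.logEnergy_eq t, hc0]
  have hyin : 0 < inertia a y := by linarith [(abs_lt.1 hyopen.2.2).1]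
  have hccont : Continuous c := continuous_iff_continuousAt.2 fun t => (hc t).2.continuousAt
  have key : ∀ t, 0 ≤ t → inertia a y < ‖amplitude a (c t)‖ ^ 2 * (1 + τ) := by
    intro t ht
    by_contra hcon
    rw [not_lt] at hcon
    have hf : Continuous fun t => ‖amplitude a (c t)‖ ^ 2 * (1 + τ) := by
      have := (continuous_amplitude (N := N) a).comp hccont
      fun_prop
    -- The inertia equals `‖A‖² (1 + ∑ ‖u_j‖² / N)`, so at the time `t'` one has `∑ ‖u_j‖² = N τ`.
    obtain ⟨t', -, ht'⟩ := intermediate_value_Icc' ht hf.continuousOn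
      (show inertia a y ∈ Set.Icc _ _ from ⟨hcon, by simpa [hc0] using hyopen.2.1.le⟩)
    simp only at ht'
    set A := amplitude a (c t') with hA
    have hA0 : A ≠ 0 := by
      intro h0
      rw [h0] at ht'
      simp at ht'
      linarith
    have hAn : 0 < ‖A‖ := norm_pos_iff.2 hA0
    set u : Fin N → ℂ := fun j => deviation a (c t') j / A with hu
    have husum : ∑ j, u j = 0 := by
      simp only [hu, ← Finset.sum_div, sum_deviation, zero_div]
    have hun : ∑ j, ‖u j‖ ^ 2 = N * τ := by
      have h1 := inertia_eq ha (c t')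
      rw [hin t', ← ht', ← hA] at h1
      have h2 : ∑ j, ‖deviation a (c t') j‖ ^ 2 = N * τ * ‖A‖ ^ 2 := by
        field_simp at h1
        linarith
      simp only [hu, norm_div, div_pow, ← Finset.sum_div, h2]
      field_simp
    have h1 := hmax u husum (by rw [hun]; exact hτη)
    have h2 := logEnergy_sub_eq ha (hc t').1 hA0
    have h3 : V (c t') = logEnergy x + relativeEnergy u := h2
    rw [hVc t'] at h3
    rw [hun] at h1
    linarith [hyopen.1]
  intro t ht
  refine nearOrbit_of_amplitude ha hτ0.le hτ4 hτε ?_ ?_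
  · rw [hin t]
    exact hyopen.2.2.le
  · rw [hin t]
    exact (key t ht).le

end Stability

/-! ### The Hessian of the augmented Hamiltonian -/

section Hessian

theorem hasDerivAt_add_ofReal_mul (ζ ω : ℂ) :
    HasDerivAt (fun s : ℝ => ζ + (s : ℂ) * ω) ω 0 := by
  simpa using ((Complex.ofRealCLM.hasDerivAt (x := (0 : ℝ))).mul_const ω).const_add ζ

theorem hasDerivAt_log_normSq {ζ : ℂ} (hζ : ζ ≠ 0) (ω : ℂ) :
    HasDerivAt (fun s : ℝ => Real.log (‖ζ + (s : ℂ) * ω‖ ^ 2)) (2 * (ω / ζ).re) 0 := by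
  have h1 := (hasDerivAt_add_ofReal_mul ζ ω).norm_sq.log (by simpa using hζ)
  refine h1.congr_deriv ?_
  have hn : ‖ζ‖ ^ 2 ≠ 0 := pow_ne_zero 2 (norm_ne_zero_iff.2 hζ)
  simp only [Complex.ofReal_zero, zero_mul, add_zero]
  rw [Complex.inner, Complex.div_re, ← Complex.normSq_eq_norm_sq]
  rw [← Complex.normSq_eq_norm_sq] at hn
  simp only [Complex.mul_re, Complex.conj_re, Complex.conj_im]
  field_simp
  ring

theorem hasDerivAt_re_div {ζ : ℂ} (hζ : ζ ≠ 0) (η ω : ℂ) :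
    HasDerivAt (fun s : ℝ => (ω / (ζ + (s : ℂ) * η)).re) (-(η / ζ * (ω / ζ)).re) 0 := by
  have h1 : HasDerivAt (fun s : ℝ => ω / (ζ + (s : ℂ) * η)) (-(η / ζ * (ω / ζ))) 0 := by
    have h2 := (hasDerivAt_const (0 : ℝ) ω).fun_div (hasDerivAt_add_ofReal_mul ζ η)
      (by simpa using hζ)
    refine h2.congr_deriv ?_
    simp only [Complex.ofReal_zero, zero_mul, add_zero, zero_sub]
    field_simp
  exact (Complex.reCLM.hasFDerivAt.comp_hasDerivAt (0 : ℝ) h1).congr_deriv (Complex.neg_re _)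

variable {N : ℕ}

/-- A combination of the squared moduli and of the pair energy: the common form of the Hamiltonian
and of the augmented Hamiltonian. -/
noncomputable def momentumEnergy (b c d : ℝ) (z : Fin N → ℂ) : ℝ :=
  b * ∑ j, ‖z j‖ ^ 2 + c * logEnergy z + d

theorem logEnergy_eq_two_mul (z : Fin N → ℂ) :
    logEnergy z = 2 * ∑ i, ∑ j ∈ Finset.Ioi i, Real.log (‖z i - z j‖ ^ 2) := by
  have h := Finset.sum_sum_Ioi_add_eq_sum_sum_off_diag
    (fun i j : Fin N => Real.log (‖z i - z j‖ ^ 2))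
  have h1 : logEnergy z = ∑ i, ∑ j ∈ {i}ᶜ, Real.log (‖z j - z i‖ ^ 2) := by
    refine Finset.sum_congr rfl fun i _ => ?_
    rw [← Finset.sum_compl_add_sum {i}]
    simp [norm_sub_rev]
  rw [h1, ← h, Finset.mul_sum]
  refine Finset.sum_congr rfl fun i _ => ?_
  rw [Finset.mul_sum]
  refine Finset.sum_congr rfl fun j _ => ?_
  rw [norm_sub_rev (z j)]
  ring

theorem augmentedHamiltonian_eq (Ω γ ξ : ℝ) (x : Fin N → ℂ) :
    augmentedHamiltonian Ω (fun _ => γ) x ξ = momentumEnergy (γ * (Ω - ξ) / 2)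
      (γ ^ 2 / (8 * Real.pi)) (momentum (fun _ => γ) x * ξ) := by
  funext z
  have hpi := Real.pi_ne_zero
  rw [augmentedHamiltonian, momentumEnergy, logEnergy_eq_two_mul, hamiltonian]
  simp only [momentum, ← Finset.mul_sum]
  field_simp
  ring

theorem contDiffAt_momentumEnergy (b c d : ℝ) {z : Fin N → ℂ} (hz : Function.Injective z) :
    ContDiffAt ℝ 2 (momentumEnergy b c d) z := by
  have h1 : ContDiffAt ℝ 2 (fun z : Fin N → ℂ => ∑ j, ‖z j‖ ^ 2) z :=
    ContDiffAt.sum fun j _ => (contDiff_apply ℝ ℂ j).contDiffAt.norm_sq ℝ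
  have h2 : ContDiffAt ℝ 2 (logEnergy : (Fin N → ℂ) → ℝ) z := by
    refine ContDiffAt.sum fun j _ => ContDiffAt.sum fun k _ => ?_
    by_cases h : j = k
    · subst h
      simpa using contDiffAt_const
    · refine ContDiffAt.log (((contDiff_apply ℝ ℂ j).contDiffAt.sub
        (contDiff_apply ℝ ℂ k).contDiffAt).norm_sq ℝ) ?_
      exact pow_ne_zero 2 (norm_ne_zero_iff.2 (sub_ne_zero.2 fun h' => h (hz h')))
  exact ((contDiffAt_const.mul h1).add (contDiffAt_const.mul h2)).add contDiffAt_const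

theorem hasDerivAt_momentumEnergy (b c d : ℝ) {z : Fin N → ℂ} (hz : Function.Injective z)
    (w : Fin N → ℂ) :
    HasDerivAt (fun s : ℝ => momentumEnergy b c d (z + s • w))
      (b * ∑ j, 2 * ((starRingEnd ℂ) (z j) * w j).re +
        c * ∑ j, ∑ k, 2 * ((w j - w k) / (z j - z k)).re) 0 := by
  have h1 : HasDerivAt (fun s : ℝ => ∑ j, ‖(z + s • w) j‖ ^ 2)
      (∑ j, 2 * ((starRingEnd ℂ) (z j) * w j).re) 0 := by
    refine HasDerivAt.fun_sum fun j _ => ?_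
    have h := (hasDerivAt_add_ofReal_mul (z j) (w j)).norm_sq
    simpa [Complex.inner, mul_comm] using h
  have h2 : HasDerivAt (fun s : ℝ => logEnergy (z + s • w))
      (∑ j, ∑ k, 2 * ((w j - w k) / (z j - z k)).re) 0 := by
    refine HasDerivAt.fun_sum fun j _ => HasDerivAt.fun_sum fun k _ => ?_
    by_cases h : j = k
    · subst h
      simpa using hasDerivAt_const (0 : ℝ) (0 : ℝ)
    · have h3 := hasDerivAt_log_normSq (sub_ne_zero.2 fun h' => h (hz h')) (w j - w k)
      refine h3.congr_of_eventuallyEq (Filter.Eventually.of_forall fun s => ?_)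
      have e : (z + s • w) j - (z + s • w) k = z j - z k + (s : ℂ) * (w j - w k) := by
        simp only [Pi.add_apply, Pi.smul_apply, Complex.real_smul]
        ring
      simp only [e]
  exact ((h1.const_mul b).add (h2.const_mul c)).add_const d

theorem fderiv_momentumEnergy (b c d : ℝ) {z : Fin N → ℂ} (hz : Function.Injective z)
    (w : Fin N → ℂ) :
    fderiv ℝ (momentumEnergy b c d) z w = b * ∑ j, 2 * ((starRingEnd ℂ) (z j) * w j).re +
        c * ∑ j, ∑ k, 2 * ((w j - w k) / (z j - z k)).re := by
  have h := ((contDiffAt_momentumEnergy b c d hz).differentiableAt (by norm_num)).hasFDerivAt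
  exact (h.hasLineDerivAt w).unique (hasDerivAt_momentumEnergy b c d hz w)

theorem eventually_injective {x : Fin N → ℂ} (hx : Function.Injective x) :
    ∀ᶠ z in nhds x, Function.Injective z := by
  have h : ∀ p : Fin N × Fin N, ∀ᶠ z in nhds x, p.1 ≠ p.2 → z p.1 ≠ z p.2 := by
    intro p
    by_cases hp : p.1 = p.2
    · exact Filter.Eventually.of_forall fun z h => absurd hp h
    · have h1 : ContinuousAt (fun z : Fin N → ℂ => z p.1 - z p.2) x := by fun_prop
      filter_upwards [h1.eventually_ne (sub_ne_zero.2 fun h' => hp (hx h'))] with z hz _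
      exact sub_ne_zero.1 hz
  filter_upwards [Filter.eventually_all.2 h] with z hz j k hjk
  by_contra hne
  exact hz (j, k) hne hjk

/-- The Hessian. As `Re log` is harmonic, the pair energy contributes the real part of a complex
bilinear form. -/
theorem fderiv_fderiv_momentumEnergy (b c d : ℝ) {x : Fin N → ℂ} (hx : Function.Injective x)
    (v w : Fin N → ℂ) :
    fderiv ℝ (fderiv ℝ (momentumEnergy b c d)) x v w =
      2 * b * (∑ j, (starRingEnd ℂ) (v j) * w j).re -
        2 * c * (∑ j, ∑ k, (v j - v k) / (x j - x k) * ((w j - w k) / (x j - x k))).re := by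
  have h1 := (((contDiffAt_momentumEnergy b c d hx).fderiv_right (m := 1)
    (by norm_num)).differentiableAt (by norm_num)).hasFDerivAt.hasLineDerivAt v
  have h2 : HasDerivAt (fun s : ℝ => fderiv ℝ (momentumEnergy b c d) (x + s • v) w)
      (fderiv ℝ (fderiv ℝ (momentumEnergy b c d)) x v w) 0 :=
    (ContinuousLinearMap.apply ℝ ℝ w).hasFDerivAt.comp_hasDerivAt (0 : ℝ) h1
  have hev : ∀ᶠ s : ℝ in nhds 0, Function.Injective (x + s • v) := by
    have hc : ContinuousAt (fun s : ℝ => x + s • v) 0 := by fun_prop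
    have := eventually_injective hx
    exact hc.eventually (by simpa using this)
  have h3 : HasDerivAt (fun s : ℝ => b * ∑ j, 2 * ((starRingEnd ℂ) ((x + s • v) j) * w j).re +
        c * ∑ j, ∑ k, 2 * ((w j - w k) / ((x + s • v) j - (x + s • v) k)).re)
      (b * ∑ j, 2 * ((starRingEnd ℂ) (v j) * w j).re +
        c * ∑ j, ∑ k, 2 * (-((v j - v k) / (x j - x k) * ((w j - w k) / (x j - x k))).re)) 0 := by
    refine ((HasDerivAt.fun_sum fun j _ => ?_).const_mul b).add
      ((HasDerivAt.fun_sum fun j _ => HasDerivAt.fun_sum fun k _ => ?_).const_mul c)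
    · have e : ∀ s : ℝ, 2 * ((starRingEnd ℂ) ((x + s • v) j) * w j).re =
          2 * ((starRingEnd ℂ) (x j) * w j).re + s * (2 * ((starRingEnd ℂ) (v j) * w j).re) := by
        intro s
        simp
        ring
      simp only [e]
      simpa using ((hasDerivAt_id (0 : ℝ)).mul_const
        (2 * ((starRingEnd ℂ) (v j) * w j).re)).const_add (2 * ((starRingEnd ℂ) (x j) * w j).re)
    · by_cases h : j = k
      · subst h
        simpa using hasDerivAt_const (0 : ℝ) (0 : ℝ)
      · have h4 := (hasDerivAt_re_div (sub_ne_zero.2 fun h' => h (hx h')) (v j - v k)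
          (w j - w k)).const_mul 2
        refine h4.congr_of_eventuallyEq (Filter.Eventually.of_forall fun s => ?_)
        have e : (x + s • v) j - (x + s • v) k = x j - x k + (s : ℂ) * (v j - v k) := by
          simp only [Pi.add_apply, Pi.smul_apply, Complex.real_smul]
          ring
        simp only [e]
  have h5 := h2.unique (h3.congr_of_eventuallyEq
    (hev.mono fun s hs => fderiv_momentumEnergy b c d hs w))
  rw [h5]
  simp only [Complex.re_sum, Finset.mul_sum, ← Finset.sum_neg_distrib, sub_eq_add_neg]
  congr 1
  · exact Finset.sum_congr rfl fun j _ => by ring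
  · exact Finset.sum_congr rfl fun j _ => Finset.sum_congr rfl fun k _ => by ring

end Hessian

/-! ### The symplectic slice -/

section Slice

variable {N : ℕ}

theorem fderiv_momentum (γ : ℝ) (x v : Fin N → ℂ) :
    fderiv ℝ (momentum (fun _ => γ)) x v = γ * (∑ j, (starRingEnd ℂ) (x j) * v j).re := by
  have hd : DifferentiableAt ℝ (momentum (fun _ : Fin N => γ)) x := by
    have h1 : ∀ j, DifferentiableAt ℝ (fun z : Fin N → ℂ => ‖z j‖ ^ 2) x := fun j =>
      ((contDiff_apply ℝ ℂ j (n := 1)).contDiffAt.norm_sq ℝ).differentiableAt (by norm_num)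
    have h2 : DifferentiableAt ℝ (fun z : Fin N → ℂ => ∑ j, γ * ‖z j‖ ^ 2) x :=
      DifferentiableAt.fun_sum fun j _ => (h1 j).const_mul γ
    unfold momentum
    simp only [div_eq_mul_inv]
    exact h2.mul_const _
  have h2 : HasDerivAt (fun s : ℝ => momentum (fun _ : Fin N => γ) (x + s • v))
      ((∑ j, γ * (2 * ((starRingEnd ℂ) (x j) * v j).re)) / 2) 0 := by
    refine (HasDerivAt.fun_sum fun j _ => HasDerivAt.const_mul γ ?_).div_const 2
    have h := (hasDerivAt_add_ofReal_mul (x j) (v j)).norm_sq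
    simpa [Complex.inner, mul_comm] using h
  rw [(hd.hasFDerivAt.hasLineDerivAt v).unique h2, ← Finset.mul_sum, ← Finset.mul_sum,
    Complex.re_sum]
  ring

/-- The two conditions on the slice are the real and the imaginary part of one complex equation. -/
theorem mem_symplecticSlice_iff {γ : ℝ} (hγ : γ ≠ 0) (x v : Fin N → ℂ) :
    v ∈ symplecticSlice (fun _ => γ) x ↔ ∑ j, (starRingEnd ℂ) (x j) * v j = 0 := by
  have h1 : v ∈ orbitNormal x ↔ (∑ j, (starRingEnd ℂ) (x j) * v j).im = 0 := by
    change ∑ j, ((v j).re * (Complex.I * x j).re + (v j).im * (Complex.I * x j).im) = 0 ↔ _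
    have e : ∑ j, ((v j).re * (Complex.I * x j).re + (v j).im * (Complex.I * x j).im) =
        (∑ j, (starRingEnd ℂ) (x j) * v j).im := by
      rw [Complex.im_sum]
      refine Finset.sum_congr rfl fun j _ => ?_
      simp
      ring
    rw [e]
  have h2 : v ∈ LinearMap.ker (fderiv ℝ (momentum (fun _ => γ)) x : (Fin N → ℂ) →ₗ[ℝ] ℝ) ↔
      (∑ j, (starRingEnd ℂ) (x j) * v j).re = 0 := by
    rw [LinearMap.mem_ker]
    change fderiv ℝ (momentum (fun _ => γ)) x v = 0 ↔ _
    rw [fderiv_momentum, mul_eq_zero, or_iff_right hγ]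
  rw [symplecticSlice, Submodule.mem_inf, h1, h2, Complex.ext_iff, and_comm]
  rfl

end Slice

/-! ### Linear instability -/

section Instability

variable {N : ℕ}

theorem pairOperator_add (u v : Fin N → ℂ) (j : Fin N) :
    pairOperator (u + v) j = pairOperator u j + pairOperator v j := by
  simp only [pairOperator, pairRatio_add, add_mul, Finset.sum_add_distrib]

theorem pairOperator_smul (c : ℂ) (u : Fin N → ℂ) (j : Fin N) :
    pairOperator (fun i => c * u i) j = c * pairOperator u j := by
  simp only [pairOperator, pairRatio, Finset.mul_sum]
  exact Finset.sum_congr rfl fun k _ => by ring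

/-- The linearised equations of motion at the regular polygon, in the rotating frame, for the
relative displacements `u_j = v_j / x_j`, where `κ = γ / (4 π |a|²)`. -/
noncomputable def linearizedField (κ : ℝ) (u : Fin N → ℂ) (j : Fin N) : ℂ :=
  -(Complex.I * κ) * ((N - 1) * u j + 2 * (starRingEnd ℂ) (pairOperator u j))

/-- The linearised equations of motion at the regular polygon, for the displacements `v_j`. -/
noncomputable def polygonLinearization (κ : ℝ) (a : ℂ) : (Fin N → ℂ) →ₗ[ℝ] (Fin N → ℂ) where
  toFun v := fun j => regularPolygon N a j *
    linearizedField κ (fun i => v i / regularPolygon N a i) j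
  map_add' v w := by
    funext j
    have e : (fun i => (v + w) i / regularPolygon N a i) =
        (fun i => v i / regularPolygon N a i) + fun i => w i / regularPolygon N a i := by
      funext i
      simp only [Pi.add_apply]
      ring
    rw [e]
    simp only [linearizedField, pairOperator_add, Pi.add_apply, map_add]
    ring
  map_smul' r v := by
    funext j
    have e : (fun i => (r • v) i / regularPolygon N a i) =
        fun i => (r : ℂ) * (v i / regularPolygon N a i) := by
      funext i
      simp only [Pi.smul_apply, Complex.real_smul]
      ring
    rw [e]
    simp only [linearizedField, pairOperator_smul, Pi.smul_apply, map_mul, Complex.conj_ofReal,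
      RingHom.id_apply, Complex.real_smul]
    ring

theorem polygonLinearization_apply (κ : ℝ) (a : ℂ) (v : Fin N → ℂ) (j : Fin N) :
    polygonLinearization κ a v j = regularPolygon N a j *
      linearizedField κ (fun i => v i / regularPolygon N a i) j := rfl

theorem regularPolygon_ne_zero {a : ℂ} (ha : a ≠ 0) (j : Fin N) : regularPolygon N a j ≠ 0 :=
  mul_ne_zero ha (unityRoot_ne_zero j)

theorem sub_div_regularPolygon_sub {a : ℂ} (ha : a ≠ 0) (u : Fin N → ℂ) (j k : Fin N) :
    (regularPolygon N a j * u j - regularPolygon N a k * u k) /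
      (regularPolygon N a j - regularPolygon N a k) = pairRatio u j k := by
  rw [pairRatio, regularPolygon_apply, regularPolygon_apply, mul_assoc, mul_assoc, ← mul_sub,
    ← mul_sub, mul_div_mul_left _ _ ha]

variable [NeZero N]

theorem conj_mul_regularPolygon (a : ℂ) (j : Fin N) :
    (starRingEnd ℂ) (regularPolygon N a j) * regularPolygon N a j = ((‖a‖ ^ 2 : ℝ) : ℂ) := by
  rw [Complex.conj_mul', regularPolygon_apply, norm_mul, norm_unityRoot, mul_one]
  push_cast
  rfl

theorem mem_symplecticSlice_regularPolygon_iff {γ : ℝ} (hγ : γ ≠ 0) {a : ℂ} (ha : a ≠ 0)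
    (u : Fin N → ℂ) :
    (fun j => regularPolygon N a j * u j) ∈
      symplecticSlice (fun _ => γ) (regularPolygon N a) ↔ ∑ j, u j = 0 := by
  rw [mem_symplecticSlice_iff hγ]
  simp only [← mul_assoc, conj_mul_regularPolygon, ← Finset.mul_sum]
  rw [mul_eq_zero, or_iff_right]
  exact Complex.ofReal_ne_zero.2 (pow_ne_zero 2 (norm_ne_zero_iff.2 ha))

theorem sum_pairOperator (u : Fin N → ℂ) :
    2 * ∑ j, pairOperator u j = ((N : ℂ) - 1) * ∑ j, u j := by
  have h := sum_pairRatio_mul_pairRatio u (fun _ => 1)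
  simp only [one_mul] at h
  rw [← h, ← sum_pairRatio]
  refine Finset.sum_congr rfl fun j _ => Finset.sum_congr rfl fun k _ => ?_
  by_cases hjk : j = k
  · simp [hjk]
  · have he : unityRoot j - unityRoot k ≠ 0 :=
      sub_ne_zero.2 fun h' => hjk (unityRoot_injective h')
    have e : pairRatio (fun _ : Fin N => (1 : ℂ)) j k = 1 := by
      rw [pairRatio, mul_one, mul_one, div_self he]
    rw [e, mul_one]

theorem sum_linearizedField (κ : ℝ) {u : Fin N → ℂ} (hu : ∑ j, u j = 0) :
    ∑ j, linearizedField κ u j = 0 := by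
  have h := sum_pairOperator u
  rw [hu, mul_zero, mul_eq_zero, or_iff_right two_ne_zero] at h
  simp only [linearizedField, ← Finset.mul_sum, Finset.sum_add_distrib, ← map_sum, hu, h]
  simp

/-- The linearised equations of motion are Hamiltonian with respect to the Hessian of the augmented
Hamiltonian. This holds on the whole phase space, so in particular on the slice. -/
theorem symplecticForm_polygonLinearization (Ω γ : ℝ) {a : ℂ} (ha : a ≠ 0) (v w : Fin N → ℂ) :
    symplecticForm (fun _ => γ)
        (polygonLinearization (γ / (4 * Real.pi * ‖a‖ ^ 2)) a v) w =
      fderiv ℝ (fderiv ℝ (augmentedHamiltonian Ω (fun _ => γ) (regularPolygon N a)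
        (polygonVelocity N Ω γ a))) (regularPolygon N a) v w := by
  obtain ⟨u, rfl⟩ : ∃ u : Fin N → ℂ, v = fun j => regularPolygon N a j * u j :=
    ⟨fun j => v j / regularPolygon N a j, funext fun j =>
      (mul_div_cancel₀ _ (regularPolygon_ne_zero ha j)).symm⟩
  obtain ⟨y, rfl⟩ : ∃ y : Fin N → ℂ, w = fun j => regularPolygon N a j * y j :=
    ⟨fun j => w j / regularPolygon N a j, funext fun j =>
      (mul_div_cancel₀ _ (regularPolygon_ne_zero ha j)).symm⟩
  have ha0 : ‖a‖ ≠ 0 := norm_ne_zero_iff.2 ha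
  have hpi := Real.pi_ne_zero
  rw [augmentedHamiltonian_eq, fderiv_fderiv_momentumEnergy _ _ _ (regularPolygon_injective ha)]
  simp only [sub_div_regularPolygon_sub ha]
  rw [sum_pairRatio_mul_pairRatio]
  set κ := γ / (4 * Real.pi * ‖a‖ ^ 2) with hκ
  have h1 : ∑ j, (starRingEnd ℂ) (regularPolygon N a j * u j) * (regularPolygon N a j * y j) =
      ((‖a‖ ^ 2 : ℝ) : ℂ) * ∑ j, (starRingEnd ℂ) (u j) * y j := by
    rw [Finset.mul_sum]
    refine Finset.sum_congr rfl fun j _ => ?_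
    rw [← conj_mul_regularPolygon a j, map_mul]
    ring
  have h2 : symplecticForm (fun _ => γ)
      (polygonLinearization κ a fun j => regularPolygon N a j * u j)
      (fun j => regularPolygon N a j * y j) =
      -(γ * κ * ‖a‖ ^ 2) * (((N : ℝ) - 1) * (∑ j, (starRingEnd ℂ) (u j) * y j).re +
        2 * (∑ j, y j * pairOperator u j).re) := by
    have e : (fun i => regularPolygon N a i * u i / regularPolygon N a i) = u :=
      funext fun i => mul_div_cancel_left₀ _ (regularPolygon_ne_zero ha i)
    rw [symplecticForm, Complex.re_sum, Complex.re_sum]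
    simp only [polygonLinearization_apply, e, Finset.mul_sum, ← Finset.sum_add_distrib]
    refine Finset.sum_congr rfl fun j _ => ?_
    have e1 : ∀ p q : ℂ, p.im * q.re - p.re * q.im = -((starRingEnd ℂ) p * q).im := by
      intro p q
      simp
      ring
    have e2 : (starRingEnd ℂ) (regularPolygon N a j * linearizedField κ u j) *
        (regularPolygon N a j * y j) = ((‖a‖ ^ 2 : ℝ) : ℂ) *
          ((κ : ℂ) * (Complex.I * (((N - 1 : ℝ) : ℂ) * ((starRingEnd ℂ) (u j) * y j) +
            ((2 : ℝ) : ℂ) * (y j * pairOperator u j)))) := by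
      rw [← conj_mul_regularPolygon a j, linearizedField]
      simp only [map_mul, map_add, map_neg, map_sub, map_one, map_natCast, map_ofNat,
        Complex.conj_I, Complex.conj_ofReal, Complex.conj_conj]
      push_cast
      ring
    rw [e1, e2, Complex.im_ofReal_mul, Complex.im_ofReal_mul, Complex.I_mul_im, Complex.add_re,
      Complex.re_ofReal_mul, Complex.re_ofReal_mul]
    ring
  rw [h1, h2, Complex.re_ofReal_mul, polygonVelocity, hκ]
  have h3 : (2 * ∑ j, y j * pairOperator u j).re = 2 * (∑ j, y j * pairOperator u j).re := by
    have := Complex.re_ofReal_mul 2 (∑ j, y j * pairOperator u j)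
    push_cast at this
    exact this
  rw [h3]
  field_simp
  ring

/-- The linearization restricted to the symplectic slice. -/
noncomputable def sliceLinearization {γ : ℝ} (hγ : γ ≠ 0) (κ : ℝ) {a : ℂ} (ha : a ≠ 0) :
    symplecticSlice (fun _ : Fin N => γ) (regularPolygon N a) →ₗ[ℝ]
      symplecticSlice (fun _ : Fin N => γ) (regularPolygon N a) :=
  (polygonLinearization κ a).restrict fun v hv => by
    have e : v = fun j => regularPolygon N a j * (v j / regularPolygon N a j) :=
      funext fun j => (mul_div_cancel₀ _ (regularPolygon_ne_zero ha j)).symm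
    rw [e, mem_symplecticSlice_regularPolygon_iff hγ ha] at hv
    exact (mem_symplecticSlice_regularPolygon_iff hγ ha _).2 (sum_linearizedField κ hv)

/-- The real displacement in the modes `3` and `N - 3`. -/
noncomputable def cosMode (N : ℕ) (j : Fin N) : ℂ := ((unityRoot j ^ 3).re : ℂ)

theorem cosMode_eq (hN : 3 ≤ N) (j : Fin N) :
    cosMode N j = 1 / 2 * (unityRoot j ^ 3 + unityRoot j ^ (N - 3)) := by
  rw [cosMode, pow_sub₀ _ (unityRoot_ne_zero j) hN, unityRoot_pow_card, one_mul, ← inv_pow,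
    ← conj_unityRoot, ← map_pow, Complex.add_conj]
  push_cast
  ring

theorem sum_cosMode (hN : 4 ≤ N) : ∑ j, cosMode N j = 0 := by
  simp only [cosMode_eq (by omega : 3 ≤ N), ← Finset.mul_sum, Finset.sum_add_distrib,
    sum_unityRoot_pow]
  rw [if_neg (Nat.not_dvd_of_pos_of_lt (by omega) (by omega)),
    if_neg (Nat.not_dvd_of_pos_of_lt (by omega) (by omega))]
  simp

theorem pairOperator_cosMode (hN : 4 ≤ N) (j : Fin N) :
    pairOperator (cosMode N) j = modeEigenvalue N 3 * cosMode N j := by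
  have e : cosMode N = fun i => 1 / 2 *
      ((fun i : Fin N => unityRoot i ^ 3) + fun i : Fin N => unityRoot i ^ (N - 3)) i := by
    funext i
    exact cosMode_eq (by omega) i
  have h : modeEigenvalue N (N - 3) = modeEigenvalue N 3 := by
    rw [modeEigenvalue, modeEigenvalue, Nat.cast_sub (by omega)]
    push_cast
    ring
  rw [e, pairOperator_smul, pairOperator_add, pairOperator_mode 3 (by omega),
    pairOperator_mode (N - 3) (by omega), h]
  simp only [Pi.add_apply]
  ring

theorem linearizedField_cosMode (hN : 4 ≤ N) (κ α β : ℝ) (j : Fin N) :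
    linearizedField κ (fun i => (α + β * Complex.I) * cosMode N i) j =
      κ * (3 * (N - 3) * β - Complex.I * ((7 - N) * α)) * cosMode N j := by
  have hc : (starRingEnd ℂ) (cosMode N j) = cosMode N j := Complex.conj_ofReal _
  rw [linearizedField, pairOperator_smul, pairOperator_cosMode hN]
  simp only [map_mul, map_add, Complex.conj_ofReal, Complex.conj_I, hc, modeEigenvalue]
  push_cast
  linear_combination (-(κ : ℂ) * (β * cosMode N j * (3 * (N - 3)))) * Complex.I_sq

/-- A real eigenvalue is an eigenvalue of the complexification. -/
theorem hasEigenvalue_baseChange {V : Type*} [AddCommGroup V] [Module ℝ V] (L : V →ₗ[ℝ] V)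
    {μ : ℝ} {v : V} (hv : v ≠ 0) (hLv : L v = μ • v) :
    Module.End.HasEigenvalue (L.baseChange ℂ) (μ : ℂ) := by
  refine Module.End.hasEigenvalue_of_hasEigenvector (x := (TensorProduct.mk ℝ ℂ V 1 v))
    ⟨Module.End.mem_eigenspace_iff.2 ?_, fun h0 => hv ?_⟩
  · rw [TensorProduct.mk_apply, LinearMap.baseChange_tmul, hLv, TensorProduct.tmul_smul,
      TensorProduct.smul_tmul', TensorProduct.smul_tmul', Complex.real_smul, smul_eq_mul]
  · refine Module.FaithfullyFlat.tensorProduct_mk_injective (A := ℝ) (B := ℂ) V ?_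
    rw [h0, map_zero]

/-- On the plane of the complex multiples of `cosMode N` the linearization is
`(α, β) ↦ κ (3 (N - 3) β, (N - 7) α)`. Its determinant is negative for `N ≥ 8`, so it has a positive
real eigenvalue. -/
theorem exists_eigenvector_linearizedField (hN : 8 ≤ N) {κ : ℝ} (hκ : κ ≠ 0) :
    ∃ (μ : ℝ) (u : Fin N → ℂ), 0 < μ ∧ ∑ j, u j = 0 ∧ u 0 ≠ 0 ∧
      ∀ j, linearizedField κ u j = μ * u j := by
  have hN8 : (8 : ℝ) ≤ N := by exact_mod_cast hN
  have hpos : 0 < 3 * ((N : ℝ) - 3) * (N - 7) := by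
    have h1 : 0 < (N : ℝ) - 3 := by linarith
    have h2 : 0 < (N : ℝ) - 7 := by linarith
    positivity
  obtain ⟨μ, hμ0, hμ2⟩ : ∃ μ : ℝ, 0 < μ ∧ μ ^ 2 = κ ^ 2 * (3 * ((N : ℝ) - 3) * (N - 7)) :=
    ⟨|κ| * √(3 * ((N : ℝ) - 3) * (N - 7)), mul_pos (abs_pos.2 hκ) (Real.sqrt_pos.2 hpos),
      by rw [mul_pow, sq_abs, Real.sq_sqrt hpos.le]⟩
  refine ⟨μ, fun i => (((κ * (3 * ((N : ℝ) - 3)) : ℝ) : ℂ) + (μ : ℂ) * Complex.I) * cosMode N i,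
    hμ0, ?_, ?_, fun j => ?_⟩
  · rw [← Finset.mul_sum, sum_cosMode (by omega), mul_zero]
  · intro h0
    have h2 := congrArg Complex.im h0
    simp [cosMode] at h2
    exact hμ0.ne' h2
  · have hμ2' : (μ : ℂ) ^ 2 = (κ : ℂ) ^ 2 * (3 * ((N : ℂ) - 3) * (N - 7)) := by
      exact_mod_cast hμ2
    rw [linearizedField_cosMode (by omega)]
    push_cast
    linear_combination (-Complex.I * cosMode N j) * hμ2'

theorem coe_sliceLinearization {γ : ℝ} (hγ : γ ≠ 0) (κ : ℝ) {a : ℂ} (ha : a ≠ 0)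
    (v : symplecticSlice (fun _ : Fin N => γ) (regularPolygon N a)) :
    (sliceLinearization hγ κ ha v : Fin N → ℂ) = polygonLinearization κ a v := rfl

theorem isSliceLinearization_sliceLinearization (Ω : ℝ) {γ : ℝ} (hγ : γ ≠ 0) {a : ℂ}
    (ha : a ≠ 0) :
    IsSliceLinearization Ω (fun _ : Fin N => γ) (regularPolygon N a) (polygonVelocity N Ω γ a)
      (sliceLinearization hγ (γ / (4 * Real.pi * ‖a‖ ^ 2)) ha) := by
  intro v w
  rw [coe_sliceLinearization]
  exact symplecticForm_polygonLinearization Ω γ ha (v : Fin N → ℂ) (w : Fin N → ℂ)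

theorem isLinearlyUnstable_regularPolygon (hN : 8 ≤ N) (Ω : ℝ) {γ : ℝ} (hγ : γ ≠ 0) {a : ℂ}
    (ha : a ≠ 0) :
    IsLinearlyUnstable Ω (fun _ : Fin N => γ) (regularPolygon N a) (polygonVelocity N Ω γ a) := by
  have hκ : γ / (4 * Real.pi * ‖a‖ ^ 2) ≠ 0 :=
    div_ne_zero hγ (mul_ne_zero (mul_ne_zero four_ne_zero Real.pi_ne_zero)
      (pow_ne_zero 2 (norm_ne_zero_iff.2 ha)))
  obtain ⟨μ, u, hμ, husum, hu0, heig⟩ := exists_eigenvector_linearizedField hN hκ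
  have hslice := (mem_symplecticSlice_regularPolygon_iff hγ ha u).2 husum
  have hv : (⟨fun j => regularPolygon N a j * u j, hslice⟩ :
      symplecticSlice (fun _ : Fin N => γ) (regularPolygon N a)) ≠ 0 := by
    intro h0
    exact mul_ne_zero (regularPolygon_ne_zero ha 0) hu0 (congrFun (congrArg Subtype.val h0) 0)
  have hLv : sliceLinearization hγ (γ / (4 * Real.pi * ‖a‖ ^ 2)) ha
      ⟨fun j => regularPolygon N a j * u j, hslice⟩ =
        μ • ⟨fun j => regularPolygon N a j * u j, hslice⟩ := by
    refine Subtype.ext (funext fun j => ?_)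
    have e : (fun i => regularPolygon N a i * u i / regularPolygon N a i) = u :=
      funext fun i => mul_div_cancel_left₀ _ (regularPolygon_ne_zero ha i)
    rw [coe_sliceLinearization, polygonLinearization_apply, e, heig, Submodule.coe_smul,
      Pi.smul_apply, Complex.real_smul]
    ring
  exact ⟨sliceLinearization hγ _ ha, isSliceLinearization_sliceLinearization Ω hγ ha, (μ : ℂ), hμ,
    hasEigenvalue_baseChange _ hv hLv⟩

end Instability

end PointVortex

theorem proposition4 (N : ℕ) (hN : 3 ≤ N) (Ω : ℝ) (γ : ℝ) (hγ : γ ≠ 0) (a : ℂ) (ha : a ≠ 0) :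
    ∃ ξ : ℝ,
      PointVortex.IsRelativeEquilibrium Ω (fun _ : Fin N => γ)
        (PointVortex.regularPolygon N a) ξ ∧
      (N ≤ 7 → PointVortex.IsLyapunovStableModSO2 Ω (fun _ : Fin N => γ)
        (PointVortex.regularPolygon N a)) ∧
      (¬ N ≤ 7 → PointVortex.IsLinearlyUnstable Ω (fun _ : Fin N => γ)
        (PointVortex.regularPolygon N a) ξ) := by
  have : NeZero N := ⟨by omega⟩
  exact ⟨PointVortex.polygonVelocity N Ω γ a,
    PointVortex.isRelativeEquilibrium_regularPolygon Ω γ ha,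
    fun h => PointVortex.isLyapunovStable_regularPolygon h Ω γ ha,
    fun h => PointVortex.isLinearlyUnstable_regularPolygon (by omega) Ω hγ ha⟩
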